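/- **Setting.** Fix constants $0<\rho\le \bar v$. A buyer takes part in $T\ge 1$ repeated second-price auctions with total budget $B=\rho T$. In round $t=1,\dots,T$ she sees her value $v_t$, chooses $x_t\in\{0,1\}$ (enter or not, bidding truthfully if she enters), and, with $p_t$ the highest competing bid, gets revenue $x_t r_t$ at cost $x_t c_t$, where $r_t=(v_t-p_t)^+$ and $c_t=p_t\mathbf 1[v_t\ge p_t]$. The values $v_1,\dots,v_T$ are i.i.d. from a distribution $F$ on $[0,\bar v]$, the bids $p_1,\dots,p_T$ are i.i.d. from a distribution $G$ on $[0,\bar v]$, and all of these are mutually independent. Feedback is full information: $p_t$ is revealed at the end of round $t$ whatever $x_t$ is. **Algorithm OGD-CB** (full information). Initialize $\mathcal I_1=\emptyset$, $B_1=B=\rho T$, $\lambda_1=0$. In round $1$ put $x_1=1$ and $\lambda_2=\lambda_1$. In round $t\ge2$, after seeing $v_t$, put $$\epsilon_t=\sqrt{\frac{\ln 2+2\ln T}{2|\mathcal I_t|}},\qquad \tilde r_t=\frac1{|\mathcal I_t|}\sum_{\tau\in\mathcal I_t}(v_t-p_\tau)^+ +\epsilon_t v_t,\qquad \tilde c_t=\frac1{|\mathcal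 I_t|}\sum_{\tau\in\mathcal I_t}p_\tau\mathbf 1[v_t\ge p_\tau]-2\epsilon_t v_t,$$ $$x_t=\mathbf 1[\tilde r_t\ge\lambda_t\tilde c_t],\qquad \lambda_{t+1}=\bigl(\lambda_t+\eta_t(x_t\tilde c_t-\rho)\bigr)^+,\qquad \eta_t=\frac1{\bar v\sqrt t}.$$ At the end of every round $t\ge 1$, put $\mathcal I_{t+1}=\mathcal I_t\cup\{t\}$ and $B_{t+1}=B_t-x_tc_t$, and stop (all later decisions are $0$) if $B_{t+1}<\bar v$. **Benchmark and regret.** Let $$\mathrm{OPT}=T\cdot\sup_{\pi}\ \mathbb E_{v\sim F,\,p\sim G}\bigl[\pi(v)(v-p)^+\bigr],$$ over measurable $\pi:[0,\bar v]\to[0,1]$ with $\mathbb E_{v\sim F,\,p\sim G}\bigl[\pi(v)\,p\,\mathbf 1[v\ge p]\bigr]\le\rho$, and let $\mathrm{Reg}=\mathrm{OPT}-\sum_{t=1}^{T}x_t(v_t-p_t)^+$ be the regret of OGD-CB. **Theorem.** There is a constant $C>0$, depending only on $\bar v$ and $\rho$, such that for all distributions $F,G$ on $[0,\bar v]$ and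 all $T\ge1$, $$\Pr\Bigl[\mathrm{Reg}\le C\sqrt{T\ln T}\Bigr]\ \ge\ 1-\frac4T ,$$ and moreover $\mathrm{Reg}$ is integrable with $\mathbb E[\mathrm{Reg}]\le C\sqrt{T\ln T}$. -/

import Mathlib

namespace Throttling

/-- Revenue `(v - p)⁺` of entering a second-price auction with value `v` (bid truthfully)
against highest competing bid `p`. -/
noncomputable def reward (v p : ℝ) : ℝ := max (v - p) 0

/-- Payment `p · 1[v ≥ p]` of entering a second-price auction with value `v`
against highest competing bid `p`. -/
noncomputable def cost (v p : ℝ) : ℝ := if p ≤ v then p else 0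

/-- A (measurable) static randomized throttling rule `π : [0, vmax] → [0, 1]`
whose expected cost per round is at most `ρ`. -/
structure Feasible (vmax ρ : ℝ) (F G : MeasureTheory.Measure ℝ) (π : ℝ → ℝ) : Prop where
  measurable : Measurable π
  mem_unit : ∀ v ∈ Set.Icc 0 vmax, π v ∈ Set.Icc (0 : ℝ) 1
  cost_le : ∫ z, π z.1 * cost z.1 z.2 ∂(F.prod G) ≤ ρ

/-- The fluid benchmark `OPT`: `T` times the optimal expected one-round revenue over
feasible static rules. -/
noncomputable def OPT (vmax ρ : ℝ) (T : ℕ) (F G : MeasureTheory.Measure ℝ) : ℝ :=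
  T * sSup {R : ℝ | ∃ π : ℝ → ℝ, Feasible vmax ρ F G π ∧
    R = ∫ z, π z.1 * reward z.1 z.2 ∂(F.prod G)}

/-- Confidence radius `ε = √((ln 2 + 2 ln T) / (2 n))` for `n` observed samples. -/
noncomputable def radius (T n : ℕ) : ℝ :=
  Real.sqrt ((Real.log 2 + 2 * Real.log T) / (2 * n))

/-- Optimistic revenue estimate at value `w` from the bids `p τ`, `τ ∈ I`. -/
noncomputable def rewardEst (T : ℕ) (p : ℕ → ℝ) (I : Finset ℕ) (w : ℝ) : ℝ :=
  (∑ τ ∈ I, reward w (p τ)) / I.card + radius T I.card * w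

/-- Optimistic cost estimate at value `w` from the bids `p τ`, `τ ∈ I`. -/
noncomputable def costEst (T : ℕ) (p : ℕ → ℝ) (I : Finset ℕ) (w : ℝ) : ℝ :=
  (∑ τ ∈ I, cost w (p τ)) / I.card - 2 * radius T I.card * w

/-- Internal state of OGD-CB at the start of a round. -/
structure State where
  /-- the rounds whose highest competing bid has been observed, `I_t` -/
  samples : Finset ℕ
  /-- the remaining budget `B_t` -/
  budget : ℝ
  /-- the pricing variable `λ_t` -/
  price : ℝ
  /-- whether the main loop has been left -/
  halted : Prop

/-- Initial state, with total budget `B = ρ T`. -/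
noncomputable def initState (ρ : ℝ) (T : ℕ) : State where
  samples := ∅
  budget := ρ * T
  price := 0
  halted := False

open Classical in
/-- The action `x_t ∈ {0, 1}` in round `t` from state `s` (it uses only `p τ` with
`τ ∈ s.samples`). No auction is entered after the loop has been left. -/
noncomputable def action (T : ℕ) (v p : ℕ → ℝ) (t : ℕ) (s : State) : ℝ :=
  if s.halted then 0
  else if t = 1 then 1
  else if s.price * costEst T p s.samples (v t) ≤ rewardEst T p s.samples (v t) then 1
  else 0

open Classical in
/-- Round `t` of OGD-CB with full information feedback: the bid `p t` is observed whatever the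
action is, the price makes an online gradient step of size `1 / (vmax √t)` (except in the
exploration round `t = 1`), and the loop is left once the remaining budget is below `vmax`. -/
noncomputable def step (vmax ρ : ℝ) (T : ℕ) (v p : ℕ → ℝ) (t : ℕ) (s : State) : State :=
  if s.halted then s
  else
    { samples := insert t s.samples
      budget := s.budget - action T v p t s * cost (v t) (p t)
      price :=
        if t = 1 then s.price
        else max (s.price + 1 / (vmax * Real.sqrt t) *
          (action T v p t s * costEst T p s.samples (v t) - ρ)) 0
      halted := s.budget - action T v p t s * cost (v t) (p t) < vmax }

/-- State of OGD-CB after `n` rounds (so at the start of round `n + 1`). Rounds are numbered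
`1, 2, …, T`. -/
noncomputable def stateAfter (vmax ρ : ℝ) (T : ℕ) (v p : ℕ → ℝ) : ℕ → State
  | 0 => initState ρ T
  | n + 1 => step vmax ρ T v p (n + 1) (stateAfter vmax ρ T v p n)

/-- Decision `x_t` of OGD-CB in round `t ≥ 1`. -/
noncomputable def decision (vmax ρ : ℝ) (T : ℕ) (v p : ℕ → ℝ) (t : ℕ) : ℝ :=
  action T v p t (stateAfter vmax ρ T v p (t - 1))

/-- Total revenue of OGD-CB over the rounds `1, …, T`. (Decisions are `0` after the last round
that is entered, so this is also the sum up to that round.) -/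
noncomputable def revenue (vmax ρ : ℝ) (T : ℕ) (v p : ℕ → ℝ) : ℝ :=
  ∑ t ∈ Finset.Icc 1 T, decision vmax ρ T v p t * reward (v t) (p t)

/-- Regret of OGD-CB against the fluid benchmark, on values `v` and competing bids `p`. -/
noncomputable def regret (vmax ρ : ℝ) (T : ℕ) (F G : MeasureTheory.Measure ℝ)
    (v p : ℕ → ℝ) : ℝ :=
  OPT vmax ρ T F G - revenue vmax ρ T v p

end Throttling

/-!
Relax the budget constraint with a multiplier. At the current price `λ_t` the algorithm maximizes
an optimistic estimate of the Lagrangian `x (reward - λ_t cost)`, so in every round it does at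
least as well as any fixed feasible rule, up to a multiple of the confidence radius; the radii add
up to `O(√(T ln T))`. The prices are the iterates of projected online gradient descent on the
dual, so that `∑ (λ_t - u) g_t = O(√T)`, up to logarithms, for every fixed multiplier `u`, where
`g_t` are the dual gradients. Comparing with the `u` given by complementary slackness (`0` if the
budget lasts, `vmax / ρ` if it runs out) pays for the rounds that are lost after stopping.

What remains are sums of bounded martingale differences, which the Azuma–Hoeffding inequality
controls; the rule in the comparison is fixed in advance, so no uniformity over rules is needed.
The bad event has probability `O(1 / T)` and the regret is at most `T vmax`, whence the bound on
the expectation for `T ≥ 2`. For `T = 1` the right-hand side vanishes, but the only auction is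
entered, and no rule has a larger mean revenue.
-/

namespace Throttling

open MeasureTheory ProbabilityTheory

open scoped NNReal

theorem apply_update_of_dependsOn {ι β : Type*} {X : ι → Type*} [DecidableEq ι]
    {f : (∀ i, X i) → β} {s : Set ι} (hf : DependsOn f s) {k : ι} (hk : k ∉ s)
    (h : ∀ i, X i) (z : X k) :
    f (Function.update h k z) = f h :=
  hf fun _ hi => Function.update_of_ne (ne_of_mem_of_not_mem hi hk) z h

theorem hasSubgaussianMGF_prod_add {α β : Type*} [MeasurableSpace α] [MeasurableSpace β]
    {μ : Measure α} {ν : Measure β} [SFinite μ] [SFinite ν] {X : α → ℝ} {Y : α → β → ℝ}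
    {cX cY : ℝ≥0}
    (hX : HasSubgaussianMGF X cX μ) (hYm : Measurable (Function.uncurry Y))
    (hY : ∀ᵐ a ∂μ, HasSubgaussianMGF (Y a) cY ν) :
    HasSubgaussianMGF (fun q : α × β => X q.1 + Y q.1 q.2) (cX + cY) (μ.prod ν) := by
  have hexp : ∀ (t : ℝ) (a : α) (b : β),
      Real.exp (t * (X a + Y a b)) = Real.exp (t * X a) * Real.exp (t * Y a b) :=
    fun t a b => by rw [mul_add, Real.exp_add]
  have hmgf : ∀ t, ∀ᵐ a ∂μ, ∫ b, Real.exp (t * (X a + Y a b)) ∂ν ≤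
      Real.exp (t * X a) * Real.exp (cY * t ^ 2 / 2) := fun t => by
    filter_upwards [hY] with a ha
    simp only [hexp, integral_const_mul]
    gcongr
    exact ha.mgf_le t
  have hint : ∀ t, Integrable
      (fun q : α × β => Real.exp (t * (X q.1 + Y q.1 q.2))) (μ.prod ν) := fun t => by
    have hmeas : AEStronglyMeasurable
        (fun q : α × β => Real.exp (t * (X q.1 + Y q.1 q.2))) (μ.prod ν) := by
      have hX' := hX.aemeasurable.comp_fst (ν := ν)
      have hYm' : Measurable fun q : α × β => Y q.1 q.2 := hYm
      exact (Real.measurable_exp.comp_aemeasurable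
        ((hX'.add hYm'.aemeasurable).const_mul t)).aestronglyMeasurable
    refine (integrable_prod_iff hmeas).2 ⟨?_, ?_⟩
    · filter_upwards [hY] with a ha
      simpa only [hexp] using (ha.integrable_exp_mul t).const_mul _
    · refine ((hX.integrable_exp_mul t).mul_const (Real.exp (cY * t ^ 2 / 2))).mono'
        hmeas.norm.integral_prod_right' ?_
      filter_upwards [hmgf t] with a ha
      simp only [Real.norm_eq_abs, Real.abs_exp]
      rwa [abs_of_nonneg (integral_nonneg fun b => (Real.exp_pos _).le)]
  refine ⟨hint, fun t => ?_⟩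
  calc mgf (fun q : α × β => X q.1 + Y q.1 q.2) (μ.prod ν) t
      = ∫ a, ∫ b, Real.exp (t * (X a + Y a b)) ∂ν ∂μ := integral_prod _ (hint t)
    _ ≤ ∫ a, Real.exp (t * X a) * Real.exp (cY * t ^ 2 / 2) ∂μ :=
        integral_mono_ae (hint t).integral_prod_left
          ((hX.integrable_exp_mul t).mul_const _) (hmgf t)
    _ = mgf X μ t * Real.exp (cY * t ^ 2 / 2) := integral_mul_const _ _
    _ ≤ Real.exp (cX * t ^ 2 / 2) * Real.exp (cY * t ^ 2 / 2) := by
        gcongr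
        exact hX.mgf_le t
    _ = Real.exp ((cX + cY : ℝ≥0) * t ^ 2 / 2) := by
        rw [← Real.exp_add, NNReal.coe_add]
        ring_nf

theorem hasSubgaussianMGF_of_ae_abs_le {Ω : Type*} [MeasurableSpace Ω] {μ : Measure Ω}
    [IsProbabilityMeasure μ] {X : Ω → ℝ} {b : ℝ} (hX : AEMeasurable X μ)
    (hb : ∀ᵐ ω ∂μ, |X ω| ≤ b) (hmean : ∫ ω, X ω ∂μ = 0) : HasSubgaussianMGF X (‖b‖₊ ^ 2) μ := by
  have hparam : (‖b - -b‖₊ / 2) ^ 2 = ‖b‖₊ ^ 2 := by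
    rw [sub_neg_eq_add, ← two_mul, nnnorm_mul]
    simp
  rw [← hparam]
  exact hasSubgaussianMGF_of_mem_Icc_of_integral_eq_zero hX (hb.mono fun ω hω => abs_le.1 hω) hmean

section ProductSpace

variable {ι : Type*} {X : ι → Type*} [∀ i, MeasurableSpace (X i)] {ν : ∀ i, Measure (X i)}
  [∀ i, IsProbabilityMeasure (ν i)]

variable (ν) in
theorem measurePreserving_update_infinitePi [DecidableEq ι] (k : ι) :
    MeasurePreserving (fun q : (∀ i, X i) × X k => Function.update q.1 k q.2)
      ((Measure.infinitePi ν).prod (ν k)) (Measure.infinitePi ν) := by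
  have hmeas : Measurable fun q : (∀ i, X i) × X k => Function.update q.1 k q.2 := by fun_prop
  refine ⟨hmeas, Measure.eq_infinitePi ν fun s t ht => ?_⟩
  have hpre : (fun q : (∀ i, X i) × X k => Function.update q.1 k q.2) ⁻¹' Set.pi s t =
      Set.pi (s.erase k) t ×ˢ (if k ∈ s then t k else Set.univ) := by
    ext q
    simp only [Set.mem_preimage, Set.mem_pi, Finset.mem_coe, Set.mem_prod, Finset.mem_erase]
    constructor
    · refine fun hq => ⟨fun i hi => by simpa [hi.1] using hq i hi.2, ?_⟩
      split_ifs with hk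
      · simpa using hq k hk
      · trivial
    · rintro ⟨hne, hk⟩ i hi
      rcases eq_or_ne i k with rfl | hik
      · simpa [hi] using hk
      · simpa [hik] using hne i ⟨hik, hi⟩
  rw [Measure.map_apply hmeas (.pi s.countable_toSet fun i _ => ht i), hpre, Measure.prod_prod,
    Measure.infinitePi_pi _ fun i _ => ht i]
  split_ifs with hk
  · rw [Finset.prod_erase_mul s _ hk]
  · rw [Finset.erase_eq_of_notMem hk, measure_univ, mul_one]

theorem measure_le_of_dependsOn_compl {k : ι} {B : (∀ i, X i) → X k → Prop} {δ : ENNReal}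
    (hB : MeasurableSet {q : (∀ i, X i) × X k | B q.1 q.2}) (hdep : DependsOn B {k}ᶜ)
    (hδ : ∀ᵐ z ∂ν k, Measure.infinitePi ν {h | B h z} ≤ δ) :
    Measure.infinitePi ν {h | B h (h k)} ≤ δ := by
  classical
  have hBk : MeasurableSet {h : ∀ i, X i | B h (h k)} :=
    hB.preimage (measurable_id.prodMk (measurable_pi_apply k))
  have hpre : (fun q : (∀ i, X i) × X k => Function.update q.1 k q.2) ⁻¹' {h | B h (h k)} =
      {q | B q.1 q.2} := by
    ext q
    simp [apply_update_of_dependsOn hdep (k := k) (by simp)]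
  calc Measure.infinitePi ν {h | B h (h k)}
      = (Measure.infinitePi ν).prod (ν k) {q | B q.1 q.2} := by
        rw [← hpre, (measurePreserving_update_infinitePi ν k).measure_preimage
          hBk.nullMeasurableSet]
    _ = ∫⁻ z, Measure.infinitePi ν {h | B h z} ∂ν k := Measure.prod_apply_symm hB
    _ ≤ ∫⁻ _, δ ∂ν k := lintegral_mono_ae hδ
    _ = δ := by simp

theorem hasSubgaussianMGF_sum_of_dependsOn [LinearOrder ι]
    {D : ∀ t, (∀ i, X i) → X t → ℝ} {c : ι → ℝ≥0} {s : Finset ι}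
    (hmeas : ∀ t ∈ s, Measurable (Function.uncurry (D t)))
    (hdep : ∀ t ∈ s, DependsOn (D t) (Set.Iio t))
    (hD : ∀ t ∈ s, ∀ᵐ h ∂Measure.infinitePi ν, HasSubgaussianMGF (D t h) (c t) (ν t)) :
    HasSubgaussianMGF (fun h => ∑ t ∈ s, D t h (h t)) (∑ t ∈ s, c t) (Measure.infinitePi ν) := by
  induction s using Finset.induction_on_max with
  | empty => simp
  | insert a s hlt ih =>
    have ha : a ∉ s := fun h => (hlt a h).false
    have hsum : Measurable fun h => ∑ t ∈ insert a s, D t h (h t) :=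
      Finset.measurable_sum _ fun t ht =>
        (hmeas t ht).comp (measurable_id.prodMk (measurable_pi_apply t))
    have hle : ∀ t ∈ insert a s, t ≤ a := by
      simpa using fun t ht => (hlt t ht).le
    have hupd : ∀ q : (∀ i, X i) × X a, ∑ t ∈ s, D t q.1 (q.1 t) + D a q.1 q.2 =
        ∑ t ∈ insert a s,
          D t (Function.update q.1 a q.2) (Function.update q.1 a q.2 t) := fun q => by
      have hD' : ∀ t ∈ insert a s, D t (Function.update q.1 a q.2) = D t q.1 := fun t ht =>
        apply_update_of_dependsOn (hdep t ht) (hle t ht).not_gt _ _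
      rw [Finset.sum_insert ha, add_comm, hD' a (Finset.mem_insert_self a s), Function.update_self]
      congr 1
      refine Finset.sum_congr rfl fun t ht => ?_
      rw [hD' t (Finset.mem_insert_of_mem ht), Function.update_of_ne (hlt t ht).ne]
    have hprod := hasSubgaussianMGF_prod_add
      (ih (fun t ht => hmeas t (Finset.mem_insert_of_mem ht))
        (fun t ht => hdep t (Finset.mem_insert_of_mem ht))
        fun t ht => hD t (Finset.mem_insert_of_mem ht))
      (hmeas a (Finset.mem_insert_self a s)) (hD a (Finset.mem_insert_self a s))
    have hpres := measurePreserving_update_infinitePi ν a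
    rw [Finset.sum_insert ha, add_comm, ← HasSubgaussianMGF.id_map_iff hsum.aemeasurable,
      ← hpres.map_eq, Measure.map_map hsum hpres.measurable,
      HasSubgaussianMGF.id_map_iff (hsum.comp hpres.measurable).aemeasurable]
    exact hprod.congr (ae_of_all _ hupd)

theorem hasSubgaussianMGF_sum_of_ae_abs_le [LinearOrder ι] {D : ∀ t, (∀ i, X i) → X t → ℝ}
    {b : ℝ} {s : Finset ι} (hmeas : ∀ t ∈ s, Measurable (Function.uncurry (D t)))
    (hdep : ∀ t ∈ s, DependsOn (D t) (Set.Iio t))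
    (hbound : ∀ t ∈ s, ∀ᵐ h ∂Measure.infinitePi ν, ∀ᵐ z ∂ν t, |D t h z| ≤ b)
    (hmean : ∀ t ∈ s, ∀ᵐ h ∂Measure.infinitePi ν, ∫ z, D t h z ∂ν t = 0) :
    HasSubgaussianMGF (fun h => ∑ t ∈ s, D t h (h t)) (s.card * ‖b‖₊ ^ 2)
      (Measure.infinitePi ν) := by
  have hsum := hasSubgaussianMGF_sum_of_dependsOn (c := fun _ => ‖b‖₊ ^ 2) hmeas hdep
    fun t ht => by
      filter_upwards [hbound t ht, hmean t ht] with h hb hm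
      exact hasSubgaussianMGF_of_ae_abs_le
        ((hmeas t ht).comp measurable_prodMk_left).aemeasurable hb hm
  rwa [Finset.sum_const, nsmul_eq_mul] at hsum

end ProductSpace

section GradientDescent

variable {E : Type*} [NormedAddCommGroup E] [InnerProductSpace ℝ E]

theorem sum_inner_le_of_norm_gradientStep_le {lam g : ℕ → E} {u : E} {w : ℕ → ℝ} {M : ℝ}
    (hw₀ : 0 ≤ w 0) (hw : StrictMono w) (hM : ∀ n, ‖lam n - u‖ ≤ M)
    (hstep : ∀ n, ‖lam (n + 1) - u‖ ≤ ‖lam n - (w (n + 1))⁻¹ • g n - u‖) (T : ℕ) :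
    ∑ n ∈ Finset.range T, inner ℝ (lam n - u) (g n) ≤
      M ^ 2 * w T / 2 + ∑ n ∈ Finset.range T, ‖g n‖ ^ 2 / (2 * w (n + 1)) := by
  have hw_nonneg : ∀ n, 0 ≤ w n := fun n => hw₀.trans (hw.monotone n.zero_le)
  have hpotential : ∀ n, inner ℝ (lam n - u) (g n) + ‖lam (n + 1) - u‖ ^ 2 * w (n + 1) / 2 ≤
      ‖lam n - u‖ ^ 2 * w (n + 1) / 2 + ‖g n‖ ^ 2 / (2 * w (n + 1)) := fun n => by
    have hpos : 0 < w (n + 1) := (hw_nonneg n).trans_lt (hw n.lt_succ_self)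
    have hexpand : ‖lam n - (w (n + 1))⁻¹ • g n - u‖ ^ 2 = ‖lam n - u‖ ^ 2 -
        2 * ((w (n + 1))⁻¹ * inner ℝ (lam n - u) (g n)) + ((w (n + 1))⁻¹ * ‖g n‖) ^ 2 := by
      rw [sub_right_comm, norm_sub_sq_real, real_inner_smul_right, norm_smul, Real.norm_eq_abs,
        abs_of_pos (inv_pos.2 hpos)]
    have hsq : ‖lam (n + 1) - u‖ ^ 2 * w (n + 1) / 2 ≤
        ‖lam n - (w (n + 1))⁻¹ • g n - u‖ ^ 2 * w (n + 1) / 2 := by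
      gcongr
      exact hstep n
    refine (add_le_add_right hsq _).trans_eq ?_
    rw [hexpand]
    field_simp
    ring
  suffices hinv : ∑ n ∈ Finset.range T, inner ℝ (lam n - u) (g n) + ‖lam T - u‖ ^ 2 * w T / 2 ≤
      M ^ 2 * w T / 2 + ∑ n ∈ Finset.range T, ‖g n‖ ^ 2 / (2 * w (n + 1)) by
    have : 0 ≤ ‖lam T - u‖ ^ 2 * w T / 2 := by have := hw_nonneg T; positivity
    linarith
  have hM_sq : ∀ n, ‖lam n - u‖ ^ 2 ≤ M ^ 2 := fun n => by gcongr; exact hM n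
  induction T with
  | zero => simpa using by have := hM_sq 0; gcongr
  | succ n ih =>
    rw [Finset.sum_range_succ, Finset.sum_range_succ]
    have := mul_le_mul_of_nonneg_right (hM_sq n) (sub_nonneg.2 (hw n.lt_succ_self).le)
    linarith [hpotential n]

end GradientDescent

theorem sum_range_one_div_sqrt_succ_le (n : ℕ) :
    ∑ i ∈ Finset.range n, 1 / √(i + 1 : ℝ) ≤ 2 * √n := by
  induction n with
  | zero => simp
  | succ n ih =>
    rw [Finset.sum_range_succ]
    push_cast
    have hsq : √(n : ℝ) ^ 2 = n := Real.sq_sqrt n.cast_nonneg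
    have hsq_succ : √(n + 1 : ℝ) ^ 2 = n + 1 := Real.sq_sqrt (by positivity)
    have hincr : 1 / √(n + 1 : ℝ) ≤ 2 * (√(n + 1 : ℝ) - √n) := by
      rw [div_le_iff₀ (by positivity)]
      nlinarith [sq_nonneg (√(n + 1 : ℝ) - √n)]
    linarith

theorem sum_range_one_div_mul_sqrt_succ_le (n : ℕ) :
    ∑ i ∈ Finset.range n, 1 / (i * √(i + 1 : ℝ)) ≤ 3 := by
  suffices htel : ∀ n : ℕ, ∑ i ∈ Finset.range (n + 1), 1 / (i * √(i + 1 : ℝ)) ≤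
      3 - 3 / √(n + 1 : ℝ) by
    rcases n with _ | n
    · simp
    · exact (htel n).trans (sub_le_self _ (by positivity))
  intro n
  induction n with
  | zero => simp
  | succ n ih =>
    rw [Finset.sum_range_succ]
    push_cast
    set a := √(n + 1 : ℝ)
    set b := √(n + 1 + 1 : ℝ)
    have ha_sq : a ^ 2 = n + 1 := Real.sq_sqrt (by positivity)
    have hb_sq : b ^ 2 = n + 1 + 1 := Real.sq_sqrt (by positivity)
    have ha : 1 ≤ a := Real.one_le_sqrt.2 (by simp)
    have hb : 0 < b := by positivity
    have hba : b ≤ 2 * a := abs_le_of_sq_le_sq' (by nlinarith) (by positivity) |>.2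
    have hgap : 1 ≤ 3 * a * (b - a) := by nlinarith
    have hincr : 1 / ((n + 1 : ℝ) * b) ≤ 3 / a - 3 / b := by
      rw [← ha_sq, div_sub_div _ _ (by positivity) hb.ne',
        div_le_div_iff₀ (by positivity) (by positivity)]
      nlinarith [mul_pos (zero_lt_one.trans_le ha) hb]
    linarith

section Trajectory

/-- A realization of the auctions: `h n` is the pair (value, highest competing bid) of round
`n + 1`, so that the quantities `price n`, `choice n`, … below refer to the start of round `n + 1`
and depend on the coordinates `i < n` only. -/
abbrev Path := ℕ → ℝ × ℝ

variable (vmax ρ : ℝ) (T n : ℕ) (h : Path)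

/-- State of OGD-CB after `n` rounds. -/
noncomputable def pathState : State :=
  stateAfter vmax ρ T (fun t => (h (t - 1)).1) (fun t => (h (t - 1)).2) n

/-- Total revenue of OGD-CB along the path. -/
noncomputable def pathRevenue : ℝ :=
  revenue vmax ρ T (fun t => (h (t - 1)).1) (fun t => (h (t - 1)).2)

open Classical in
/-- Indicator that the main loop has not been left after `n` rounds. -/
noncomputable def alive : ℝ := if (pathState vmax ρ T n h).halted then 0 else 1

/-- The pricing variable after `n` rounds. -/
noncomputable def price : ℝ := (pathState vmax ρ T n h).price

/-- Optimistic revenue estimate at value `w` from the first `n` bids. It vanishes for `n = 0`,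
because of the junk value `radius T 0 = 0`. -/
noncomputable def rewardUCB (w : ℝ) : ℝ :=
  (∑ i ∈ Finset.range n, reward w (h i).2) / n + radius T n * w

/-- Optimistic cost estimate at value `w` from the first `n` bids. It vanishes for `n = 0`,
because of the junk value `radius T 0 = 0`. -/
noncomputable def costLCB (w : ℝ) : ℝ :=
  (∑ i ∈ Finset.range n, cost w (h i).2) / n - 2 * radius T n * w

open Classical in
/-- Decision in round `n + 1` at value `w`. For `n = 0` both estimates vanish, so that the
exploration round needs no separate case. -/
noncomputable def choice (w : ℝ) : ℝ :=
  if price vmax ρ T n h * costLCB T n h w ≤ rewardUCB T n h w then alive vmax ρ T n h else 0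

/-- Total payment in the first `n` rounds. -/
noncomputable def spent : ℝ :=
  ∑ i ∈ Finset.range n, choice vmax ρ T i h (h i).1 * cost (h i).1 (h i).2

/-- Gradient of the dual objective in round `n + 1`. It vanishes once the loop has been left,
so that the price makes a projected gradient step in every round. -/
noncomputable def gradient : ℝ :=
  alive vmax ρ T n h * (ρ - choice vmax ρ T n h (h n).1 * costLCB T n h (h n).1)

theorem sum_Icc_one_eq_sum_range (f : ℕ → ℝ) :
    ∑ t ∈ Finset.Icc 1 n, f t = ∑ i ∈ Finset.range n, f (i + 1) := by
  rw [← Finset.Ico_add_one_right_eq_Icc, Finset.sum_Ico_eq_sum_range]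
  simp only [Nat.add_sub_cancel, add_comm]

theorem rewardEst_eq_rewardUCB (w : ℝ) :
    rewardEst T (fun t => (h (t - 1)).2) (Finset.Icc 1 n) w = rewardUCB T n h w := by
  simp [rewardEst, rewardUCB, sum_Icc_one_eq_sum_range]

theorem costEst_eq_costLCB (w : ℝ) :
    costEst T (fun t => (h (t - 1)).2) (Finset.Icc 1 n) w = costLCB T n h w := by
  simp [costEst, costLCB, sum_Icc_one_eq_sum_range]

theorem alive_eq_zero_or_one : alive vmax ρ T n h = 0 ∨ alive vmax ρ T n h = 1 := by
  unfold alive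
  split_ifs <;> simp

@[simp]
theorem alive_zero : alive vmax ρ T 0 h = 1 := by
  simp [alive, pathState, stateAfter, initState]

@[simp]
theorem price_zero : price vmax ρ T 0 h = 0 := rfl

@[simp]
theorem rewardUCB_zero (w : ℝ) : rewardUCB T 0 h w = 0 := by simp [rewardUCB, radius]

@[simp]
theorem costLCB_zero (w : ℝ) : costLCB T 0 h w = 0 := by simp [costLCB, radius]

theorem choice_zero (w : ℝ) : choice vmax ρ T 0 h w = 1 := by simp [choice]

theorem gradient_zero : gradient vmax ρ T 0 h = ρ := by simp [gradient]

theorem choice_eq_zero_or_one (w : ℝ) :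
    choice vmax ρ T n h w = 0 ∨ choice vmax ρ T n h w = 1 := by
  have := alive_eq_zero_or_one vmax ρ T n h
  unfold choice
  split_ifs <;> simp_all

theorem choice_mem_Icc (w : ℝ) : choice vmax ρ T n h w ∈ Set.Icc (0 : ℝ) 1 := by
  rcases choice_eq_zero_or_one vmax ρ T n h w with hx | hx <;> simp [hx]

theorem alive_mem_Icc : alive vmax ρ T n h ∈ Set.Icc (0 : ℝ) 1 := by
  rcases alive_eq_zero_or_one vmax ρ T n h with ha | ha <;> simp [ha]

variable {vmax ρ T n h}

theorem choice_of_alive_eq_zero (ha : alive vmax ρ T n h = 0) (w : ℝ) :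
    choice vmax ρ T n h w = 0 := by
  simp [choice, ha]

theorem samples_pathState (hn : ¬(pathState vmax ρ T n h).halted) :
    (pathState vmax ρ T n h).samples = Finset.Icc 1 n := by
  induction n with
  | zero => rfl
  | succ n ih =>
    rw [pathState, stateAfter, ← pathState, step] at hn ⊢
    by_cases hh : (pathState vmax ρ T n h).halted
    · exact absurd hh (by rwa [if_pos hh] at hn)
    · rw [if_neg hh, ih hh, Finset.insert_Icc_right_eq_Icc_add_one (by simp)]

variable (vmax ρ T n h)

theorem action_pathState :
    action T (fun t => (h (t - 1)).1) (fun t => (h (t - 1)).2) (n + 1) (pathState vmax ρ T n h) =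
      choice vmax ρ T n h (h n).1 := by
  by_cases hh : (pathState vmax ρ T n h).halted
  · rw [choice_of_alive_eq_zero (if_pos hh), action, if_pos hh]
  rcases eq_or_ne n 0 with rfl | hn
  · rw [choice_zero, action, if_neg hh, if_pos rfl]
  · rw [action, if_neg hh, if_neg (by simpa), samples_pathState hh]
    simp only [costEst_eq_costLCB, rewardEst_eq_rewardUCB, choice, alive, if_neg hh, price,
      Nat.add_sub_cancel]

theorem pathRevenue_eq_sum_choice :
    pathRevenue vmax ρ T h =
      ∑ n ∈ Finset.range T, choice vmax ρ T n h (h n).1 * reward (h n).1 (h n).2 := by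
  rw [pathRevenue, revenue, sum_Icc_one_eq_sum_range]
  refine Finset.sum_congr rfl fun n _ => ?_
  rw [decision, Nat.add_sub_cancel, ← pathState, action_pathState]

theorem budget_pathState :
    (pathState vmax ρ T n h).budget = ρ * T - spent vmax ρ T n h := by
  induction n with
  | zero => simp [pathState, stateAfter, initState, spent]
  | succ n ih =>
    rw [spent, Finset.sum_range_succ, ← spent, pathState, stateAfter, ← pathState, step]
    by_cases hh : (pathState vmax ρ T n h).halted
    · rw [if_pos hh, choice_of_alive_eq_zero (if_pos hh), ih]
      ring
    · rw [if_neg hh]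
      simp only [action_pathState, ih, Nat.add_sub_cancel]
      ring

open Classical in
theorem alive_succ : alive vmax ρ T (n + 1) h =
    if ρ * T - spent vmax ρ T (n + 1) h < vmax then 0 else alive vmax ρ T n h := by
  rw [← budget_pathState, alive, alive, pathState, stateAfter, ← pathState, step]
  by_cases hh : (pathState vmax ρ T n h).halted
  · simp [hh]
  · simp only [hh, if_false]

theorem price_nonneg : 0 ≤ price vmax ρ T n h := by
  induction n with
  | zero => exact le_rfl
  | succ n ih =>
    rw [price, pathState, stateAfter, ← pathState, step]
    split_ifs
    exacts [ih, ih, le_max_right _ _]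

variable {vmax ρ}

theorem price_succ (hv : 0 ≤ vmax) (hρ : 0 ≤ ρ) : price vmax ρ T (n + 1) h =
    max (price vmax ρ T n h - (vmax * √(n + 1 : ℕ))⁻¹ * gradient vmax ρ T n h) 0 := by
  have hprice : (pathState vmax ρ T n h).price = price vmax ρ T n h := rfl
  rw [price, pathState, stateAfter, ← pathState, step]
  by_cases hh : (pathState vmax ρ T n h).halted
  · have ha : alive vmax ρ T n h = 0 := if_pos hh
    rw [if_pos hh, gradient, ha, zero_mul, mul_zero, sub_zero, hprice,
      max_eq_left (price_nonneg vmax ρ T n h)]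
  have ha : alive vmax ρ T n h = 1 := if_neg hh
  rw [if_neg hh]
  rcases eq_or_ne n 0 with rfl | hn
  · have : 0 ≤ vmax⁻¹ * ρ := by positivity
    simp only [zero_add, if_true, hprice, price_zero, gradient_zero, Nat.cast_one, Real.sqrt_one,
      mul_one, zero_sub]
    rw [max_eq_right (by linarith)]
  · simp only [action_pathState, samples_pathState hh, costEst_eq_costLCB, Nat.add_eq_right, hn,
      if_false, Nat.add_sub_cancel, hprice, gradient, ha, one_div]
    ring_nf

variable {T n h}

/-- The path takes its values in `[0, vmax] × [0, vmax]`. -/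
def InBox (vmax : ℝ) (h : Path) : Prop :=
  ∀ n, (h n).1 ∈ Set.Icc 0 vmax ∧ (h n).2 ∈ Set.Icc 0 vmax

theorem reward_mem_Icc {w p : ℝ} (hw : 0 ≤ w) (hp : 0 ≤ p) : reward w p ∈ Set.Icc 0 w :=
  ⟨le_max_right _ _, max_le (by linarith) hw⟩

theorem cost_mem_Icc {w p : ℝ} (hw : 0 ≤ w) (hp : 0 ≤ p) : cost w p ∈ Set.Icc 0 w := by
  unfold cost
  split_ifs with hpw
  exacts [⟨hp, hpw⟩, ⟨le_rfl, hw⟩]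

theorem InBox.monotone_spent (hh : InBox vmax h) : Monotone fun n => spent vmax ρ T n h :=
  monotone_nat_of_le_succ fun n => by
    simp only [spent, Finset.sum_range_succ]
    have := mul_nonneg (choice_mem_Icc vmax ρ T n h (h n).1).1
      (cost_mem_Icc (hh n).1.1 (hh n).2.1).1
    linarith

theorem InBox.budget_lt_of_alive_eq_zero (hh : InBox vmax h) (ha : alive vmax ρ T n h = 0) :
    ρ * T - spent vmax ρ T n h < vmax := by
  induction n with
  | zero => simp at ha
  | succ n ih =>
    rw [alive_succ] at ha
    split_ifs at ha with hlt
    · exact hlt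
    · exact (sub_le_sub_left (hh.monotone_spent n.le_succ) _).trans_lt (ih ha)

section Predictability

theorem dependsOn_rewardUCB : DependsOn (rewardUCB T n) (Set.Iio n) := fun h h' hhh' => by
  funext w
  rw [rewardUCB, rewardUCB, Finset.sum_congr rfl fun i hi => by rw [hhh' i (Finset.mem_range.1 hi)]]

theorem dependsOn_costLCB : DependsOn (costLCB T n) (Set.Iio n) := fun h h' hhh' => by
  funext w
  rw [costLCB, costLCB, Finset.sum_congr rfl fun i hi => by rw [hhh' i (Finset.mem_range.1 hi)]]

theorem choice_eq_of_forall_lt {h' : Path} (hhh' : ∀ i < n, h i = h' i)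
    (ha : alive vmax ρ T n h = alive vmax ρ T n h')
    (hp : price vmax ρ T n h = price vmax ρ T n h') :
    choice vmax ρ T n h = choice vmax ρ T n h' := by
  funext w
  rw [choice, choice, ha, hp, dependsOn_rewardUCB hhh', dependsOn_costLCB hhh']

theorem dependsOn_alive_price_spent (hv : 0 ≤ vmax) (hρ : 0 ≤ ρ) (n : ℕ) :
    DependsOn (fun h => (alive vmax ρ T n h, price vmax ρ T n h, spent vmax ρ T n h))
      (Set.Iio n) := by
  intro h h' hhh'
  induction n with
  | zero => simp [spent]
  | succ n ih =>
    have hlt : ∀ i < n, h i = h' i := fun i hi => hhh' i (hi.trans n.lt_succ_self)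
    have hn : h n = h' n := hhh' n n.lt_succ_self
    obtain ⟨ha, hp, hs⟩ : _ ∧ _ ∧ _ := by simpa only [Prod.mk.injEq] using ih hlt
    have hx := choice_eq_of_forall_lt hlt ha hp
    have hg : gradient vmax ρ T n h = gradient vmax ρ T n h' := by
      rw [gradient, gradient, ha, hx, hn, dependsOn_costLCB hlt]
    have hs' : spent vmax ρ T (n + 1) h = spent vmax ρ T (n + 1) h' := by
      rw [spent, spent, Finset.sum_range_succ, Finset.sum_range_succ, ← spent, ← spent, hs, hx, hn]
    simp only [alive_succ, price_succ T n _ hv hρ, ha, hp, hg, hs']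

theorem dependsOn_alive (hv : 0 ≤ vmax) (hρ : 0 ≤ ρ) :
    DependsOn (alive vmax ρ T n) (Set.Iio n) := fun _ _ hhh' =>
  congrArg Prod.fst (dependsOn_alive_price_spent hv hρ n hhh')

theorem dependsOn_price (hv : 0 ≤ vmax) (hρ : 0 ≤ ρ) :
    DependsOn (price vmax ρ T n) (Set.Iio n) := fun _ _ hhh' =>
  congrArg (fun s => s.2.1) (dependsOn_alive_price_spent hv hρ n hhh')

theorem dependsOn_choice (hv : 0 ≤ vmax) (hρ : 0 ≤ ρ) :
    DependsOn (choice vmax ρ T n) (Set.Iio n) := fun _ _ hhh' =>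
  choice_eq_of_forall_lt hhh' (dependsOn_alive hv hρ hhh') (dependsOn_price hv hρ hhh')

end Predictability

section Measurability

@[fun_prop]
theorem measurable_reward : Measurable fun z : ℝ × ℝ => reward z.1 z.2 := by
  unfold reward
  fun_prop

@[fun_prop]
theorem measurable_cost : Measurable fun z : ℝ × ℝ => cost z.1 z.2 :=
  Measurable.ite (measurableSet_le measurable_snd measurable_fst) measurable_snd measurable_const

theorem measurable_rewardUCB : Measurable fun q : Path × ℝ => rewardUCB T n q.1 q.2 := by
  have (i : ℕ) : Measurable fun q : Path × ℝ => reward q.2 (q.1 i).2 :=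
    measurable_reward.comp (f := fun q : Path × ℝ => (q.2, (q.1 i).2)) (by fun_prop)
  unfold rewardUCB
  fun_prop

theorem measurable_costLCB : Measurable fun q : Path × ℝ => costLCB T n q.1 q.2 := by
  have (i : ℕ) : Measurable fun q : Path × ℝ => cost q.2 (q.1 i).2 :=
    measurable_cost.comp (f := fun q : Path × ℝ => (q.2, (q.1 i).2)) (by fun_prop)
  unfold costLCB
  fun_prop

theorem measurable_choice_of_alive_of_price (ha : Measurable (alive vmax ρ T n))
    (hp : Measurable (price vmax ρ T n)) :
    Measurable fun q : Path × ℝ => choice vmax ρ T n q.1 q.2 :=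
  Measurable.ite (measurableSet_le ((hp.comp measurable_fst).mul measurable_costLCB)
    measurable_rewardUCB) (ha.comp measurable_fst) measurable_const

theorem measurable_alive_price_spent (hv : 0 ≤ vmax) (hρ : 0 ≤ ρ) (n : ℕ) :
    Measurable (alive vmax ρ T n) ∧ Measurable (price vmax ρ T n) ∧
      Measurable (spent vmax ρ T n) := by
  induction n with
  | zero =>
    refine ⟨?_, measurable_const (a := (0 : ℝ)), measurable_const (a := (0 : ℝ))⟩
    rw [funext (alive_zero vmax ρ T)]
    exact measurable_const
  | succ n ih =>
    obtain ⟨ha, hp, hs⟩ := ih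
    have hvalue : Measurable fun h : Path => (h, (h n).1) := by fun_prop
    have hx := (measurable_choice_of_alive_of_price ha hp).comp hvalue
    have hg : Measurable (gradient vmax ρ T n) :=
      ha.mul ((hx.mul (measurable_costLCB.comp hvalue)).const_sub _)
    have hs' : Measurable (spent vmax ρ T (n + 1)) := by
      have hsucc : spent vmax ρ T (n + 1) = fun h =>
          spent vmax ρ T n h + choice vmax ρ T n h (h n).1 * cost (h n).1 (h n).2 :=
        funext fun h => Finset.sum_range_succ _ n
      rw [hsucc]
      exact hs.add (hx.mul (measurable_cost.comp (measurable_pi_apply n)))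
    refine ⟨?_, ?_, hs'⟩
    · have hsucc : alive vmax ρ T (n + 1) = _ := funext (alive_succ vmax ρ T n)
      rw [hsucc]
      exact .ite (measurableSet_lt (hs'.const_sub _) measurable_const) measurable_const ha
    · have hsucc : price vmax ρ T (n + 1) = _ := funext fun h => price_succ T n h hv hρ
      rw [hsucc]
      exact (hp.sub (hg.const_mul _)).max measurable_const

theorem measurable_alive (hv : 0 ≤ vmax) (hρ : 0 ≤ ρ) : Measurable (alive vmax ρ T n) :=
  (measurable_alive_price_spent hv hρ n).1

theorem measurable_price (hv : 0 ≤ vmax) (hρ : 0 ≤ ρ) : Measurable (price vmax ρ T n) :=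
  (measurable_alive_price_spent hv hρ n).2.1

theorem measurable_choice (hv : 0 ≤ vmax) (hρ : 0 ≤ ρ) :
    Measurable fun q : Path × ℝ => choice vmax ρ T n q.1 q.2 :=
  measurable_choice_of_alive_of_price (measurable_alive hv hρ) (measurable_price hv hρ)

end Measurability

end Trajectory

section Estimates

variable {T n : ℕ}

/-- The logarithmic factor `ln 2 + 2 ln T` in the confidence radius. -/
noncomputable def logLevel (T : ℕ) : ℝ := Real.log 2 + 2 * Real.log T

/-- The scale `√(T (ln 2 + 2 ln T))` of the deviations over `T` rounds. -/
noncomputable def deviation (T : ℕ) : ℝ := √(T * logLevel T)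

theorem logLevel_nonneg (T : ℕ) : 0 ≤ logLevel T :=
  add_nonneg (Real.log_nonneg one_le_two) (mul_nonneg zero_le_two (Real.log_natCast_nonneg T))

theorem sq_deviation (T : ℕ) : deviation T ^ 2 = T * logLevel T :=
  Real.sq_sqrt (mul_nonneg T.cast_nonneg (logLevel_nonneg T))

theorem deviation_nonneg (T : ℕ) : 0 ≤ deviation T := Real.sqrt_nonneg _

theorem one_le_logLevel (hT : 2 ≤ T) : 1 ≤ logLevel T := by
  have hlog : Real.log 2 ≤ Real.log T := Real.log_le_log two_pos (by exact_mod_cast hT)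
  rw [logLevel]
  linarith [Real.log_two_gt_d9]

theorem sqrt_le_deviation (hT : 2 ≤ T) : √T ≤ deviation T :=
  Real.sqrt_le_sqrt (le_mul_of_one_le_right T.cast_nonneg (one_le_logLevel hT))

theorem one_le_deviation (hT : 2 ≤ T) : 1 ≤ deviation T :=
  (Real.one_le_sqrt.2 (by exact_mod_cast one_le_two.trans hT)).trans (sqrt_le_deviation hT)

theorem logLevel_le_two_mul_deviation (hT : 1 ≤ T) : logLevel T ≤ 2 * deviation T := by
  have hT' : (1 : ℝ) ≤ T := by exact_mod_cast hT
  have hlog : Real.log T ≤ T - 1 := Real.log_le_sub_one_of_pos (by linarith)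
  have hle : logLevel T ≤ 4 * T := by
    rw [logLevel]
    linarith [Real.log_two_lt_d9]
  refine abs_le_of_sq_le_sq' ?_ (mul_nonneg zero_le_two (deviation_nonneg T)) |>.2
  rw [mul_pow, sq_deviation]
  nlinarith [logLevel_nonneg T]

theorem radius_nonneg : 0 ≤ radius T n := Real.sqrt_nonneg _

theorem sq_radius : radius T n ^ 2 = logLevel T / (2 * n) :=
  Real.sq_sqrt (div_nonneg (logLevel_nonneg T) (by positivity))

theorem radius_eq_mul_one_div_sqrt : radius T n = √(logLevel T / 2) * (1 / √n) := by
  rw [radius, ← logLevel, ← div_div, Real.sqrt_div' _ n.cast_nonneg, mul_one_div]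

theorem sum_radius_le : ∑ n ∈ Finset.range T, radius T n ≤ 2 * deviation T := by
  have hsum : ∑ n ∈ Finset.range T, 1 / √(n : ℝ) ≤ 2 * √T := by
    rcases T with _ | T
    · simp
    · rw [Finset.sum_range_succ', Nat.cast_zero, Real.sqrt_zero, div_zero, add_zero]
      push_cast
      exact (sum_range_one_div_sqrt_succ_le T).trans (by gcongr; simp)
  calc ∑ n ∈ Finset.range T, radius T n
      = √(logLevel T / 2) * ∑ n ∈ Finset.range T, 1 / √(n : ℝ) := by
        rw [Finset.mul_sum]
        exact Finset.sum_congr rfl fun n _ => radius_eq_mul_one_div_sqrt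
    _ ≤ √(logLevel T) * (2 * √T) := by
        gcongr
        exact half_le_self (logLevel_nonneg T)
    _ = 2 * deviation T := by
        rw [deviation, Real.sqrt_mul T.cast_nonneg]
        ring

theorem sum_range_div_mem_Icc {f : ℕ → ℝ} {b : ℝ} (hf : ∀ i, f i ∈ Set.Icc 0 b) (n : ℕ) :
    (∑ i ∈ Finset.range n, f i) / n ∈ Set.Icc 0 b := by
  refine ⟨div_nonneg (Finset.sum_nonneg fun i _ => (hf i).1) n.cast_nonneg,
    div_le_of_le_mul₀ n.cast_nonneg ((hf 0).1.trans (hf 0).2) ?_⟩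
  exact (Finset.sum_le_card_nsmul _ _ _ fun i _ => (hf i).2).trans_eq (by simp [mul_comm])

variable {vmax : ℝ} {h : Path}

theorem InBox.rewardUCB_mem_Icc (hh : InBox vmax h) {w : ℝ} (hw : 0 ≤ w) :
    rewardUCB T n h w ∈ Set.Icc 0 (w + radius T n * w) := by
  have hmean := sum_range_div_mem_Icc (fun i => reward_mem_Icc hw (hh i).2.1) n
  have hradius := mul_nonneg (radius_nonneg (T := T) (n := n)) hw
  exact ⟨add_nonneg hmean.1 hradius, add_le_add_left hmean.2 _⟩

theorem InBox.costLCB_mem_Icc (hh : InBox vmax h) {w : ℝ} (hw : 0 ≤ w) :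
    costLCB T n h w ∈ Set.Icc (-(2 * radius T n * w)) (w - 2 * radius T n * w) := by
  have hmean := sum_range_div_mem_Icc (fun i => cost_mem_Icc hw (hh i).2.1) n
  exact ⟨by rw [costLCB]; linarith [hmean.1], sub_le_sub_right hmean.2 _⟩

end Estimates

section DualDescent

variable {vmax ρ : ℝ} {T n : ℕ} {h : Path}

/-- Upper bound for the pricing variable. -/
noncomputable def priceBound (vmax ρ : ℝ) : ℝ := 3 / 2 * (vmax / ρ) + 1

theorem div_le_priceBound (hρ : 0 < ρ) (hρv : ρ ≤ vmax) : vmax / ρ ≤ priceBound vmax ρ := by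
  have : 0 < vmax / ρ := div_pos (hρ.trans_le hρv) hρ
  rw [priceBound]
  linarith

theorem InBox.gradient_mem_Icc (hh : InBox vmax h) (hρ : 0 < ρ) (hρv : ρ ≤ vmax) :
    gradient vmax ρ T n h ∈ Set.Icc (-vmax) (vmax * (1 + 2 * radius T n)) := by
  have hw := (hh n).1
  have hc := hh.costLCB_mem_Icc (T := T) (n := n) hw.1
  have hradius := radius_nonneg (T := T) (n := n)
  have hmul : radius T n * (h n).1 ∈ Set.Icc 0 (radius T n * vmax) :=
    ⟨mul_nonneg hradius hw.1, mul_le_mul_of_nonneg_left hw.2 hradius⟩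
  rw [Set.mem_Icc] at hc hmul hw
  rw [gradient]
  rcases alive_eq_zero_or_one vmax ρ T n h with ha | ha
  · have : 0 ≤ vmax * (1 + 2 * radius T n) := by have := hρ.trans_le hρv; positivity
    rw [ha, zero_mul]
    exact ⟨by linarith, this⟩
  · rcases choice_eq_zero_or_one vmax ρ T n h (h n).1 with hx | hx <;>
    · rw [ha, hx]
      constructor <;> linarith

theorem InBox.sq_gradient_le (hh : InBox vmax h) (hρ : 0 < ρ) (hρv : ρ ≤ vmax) :
    gradient vmax ρ T n h ^ 2 ≤ vmax ^ 2 * (2 + 8 * radius T n ^ 2) := by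
  obtain ⟨hlower, hupper⟩ := hh.gradient_mem_Icc (T := T) (n := n) hρ hρv
  have hradius : 0 ≤ vmax * (2 * radius T n) := by
    have := hρ.trans_le hρv
    have := radius_nonneg (T := T) (n := n)
    positivity
  have hsq : gradient vmax ρ T n h ^ 2 ≤ (vmax * (1 + 2 * radius T n)) ^ 2 :=
    sq_le_sq' (by linarith) hupper
  nlinarith [mul_nonneg (sq_nonneg vmax) (sq_nonneg (1 - 2 * radius T n))]

theorem InBox.price_le_of_gradient_neg (hh : InBox vmax h) (hρ : 0 < ρ)
    (hg : gradient vmax ρ T n h < 0) : price vmax ρ T n h ≤ 3 / 2 * (vmax / ρ) := by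
  have hw := (hh n).1
  have hc := (hh.costLCB_mem_Icc (T := T) (n := n) hw.1).2
  have hr := (hh.rewardUCB_mem_Icc (T := T) (n := n) hw.1).2
  rw [gradient] at hg
  rcases alive_eq_zero_or_one vmax ρ T n h with ha | ha
  · simp [ha] at hg
  rw [choice, ha] at hg
  split_ifs at hg with hle
  · have hcost : ρ ≤ costLCB T n h (h n).1 := by linarith
    have hpc := mul_le_mul_of_nonneg_left hcost (price_nonneg vmax ρ T n h)
    rw [← mul_div_assoc, le_div_iff₀ hρ]
    linarith [hw.2]
  · linarith

theorem InBox.price_le (hh : InBox vmax h) (hρ : 0 < ρ) (hρv : ρ ≤ vmax) (n : ℕ) :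
    price vmax ρ T n h ≤ priceBound vmax ρ := by
  have hv : 0 < vmax := hρ.trans_le hρv
  have hpos : 0 ≤ priceBound vmax ρ := by unfold priceBound; positivity
  induction n with
  | zero => exact hpos
  | succ n ih =>
    rw [price_succ T n h hv.le hρ.le]
    refine max_le ?_ hpos
    have hw : vmax ≤ vmax * √(n + 1 : ℕ) :=
      le_mul_of_one_le_right hv.le (Real.one_le_sqrt.2 (by simp))
    rcases le_or_gt 0 (gradient vmax ρ T n h) with hg | hg
    · exact (sub_le_self _ (mul_nonneg (inv_nonneg.2 (hv.le.trans hw)) hg)).trans ih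
    · have hprice := hh.price_le_of_gradient_neg hρ hg
      have hincr : -1 ≤ (vmax * √(n + 1 : ℕ))⁻¹ * gradient vmax ρ T n h := by
        rw [le_inv_mul_iff₀ (hv.trans_le hw)]
        linarith [(hh.gradient_mem_Icc (T := T) (n := n) hρ hρv).1]
      rw [priceBound]
      linarith

theorem abs_price_succ_sub_le (hv : 0 ≤ vmax) (hρ : 0 ≤ ρ) {u : ℝ} (hu : 0 ≤ u) :
    |price vmax ρ T (n + 1) h - u| ≤
      |price vmax ρ T n h - (vmax * √(n + 1 : ℕ))⁻¹ * gradient vmax ρ T n h - u| := by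
  simpa only [price_succ T n h hv hρ, max_eq_left hu] using abs_max_sub_max_le_abs _ u 0

theorem InBox.sum_sq_gradient_div_le (hh : InBox vmax h) (hρ : 0 < ρ) (hρv : ρ ≤ vmax) :
    ∑ n ∈ Finset.range T, ‖gradient vmax ρ T n h‖ ^ 2 / (2 * (vmax * √(n + 1 : ℕ))) ≤
      vmax * (2 * √T + 6 * logLevel T) := by
  have hv : 0 < vmax := hρ.trans_le hρv
  calc ∑ n ∈ Finset.range T, ‖gradient vmax ρ T n h‖ ^ 2 / (2 * (vmax * √(n + 1 : ℕ)))
      ≤ ∑ n ∈ Finset.range T, vmax * (1 / √(n + 1 : ℝ) +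
          2 * logLevel T * (1 / (n * √(n + 1 : ℝ)))) := by
        refine Finset.sum_le_sum fun n _ => ?_
        rw [Real.norm_eq_abs, sq_abs, div_le_iff₀ (by positivity), Nat.cast_succ]
        refine (hh.sq_gradient_le hρ hρv).trans_eq ?_
        rw [sq_radius]
        rcases eq_or_ne (n : ℝ) 0 with hn | hn
        · simp [hn]
          ring
        · field_simp
          ring
    _ ≤ vmax * (2 * √T + 2 * logLevel T * 3) := by
        rw [← Finset.mul_sum, Finset.sum_add_distrib, ← Finset.mul_sum]
        have := logLevel_nonneg T
        gcongr
        · exact sum_range_one_div_sqrt_succ_le T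
        · exact sum_range_one_div_mul_sqrt_succ_le T
    _ = vmax * (2 * √T + 6 * logLevel T) := by ring

theorem InBox.sum_sub_mul_gradient_le (hh : InBox vmax h) (hρ : 0 < ρ) (hρv : ρ ≤ vmax)
    (hT : 2 ≤ T) {u : ℝ} (hu : u ∈ Set.Icc 0 (priceBound vmax ρ)) :
    ∑ n ∈ Finset.range T, (price vmax ρ T n h - u) * gradient vmax ρ T n h ≤
      vmax * (priceBound vmax ρ ^ 2 / 2 + 14) * deviation T := by
  have hv : 0 < vmax := hρ.trans_le hρv
  have hweight : StrictMono fun n : ℕ => vmax * √(n : ℝ) := fun m n hmn =>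
    mul_lt_mul_of_pos_left (Real.sqrt_lt_sqrt m.cast_nonneg (by exact_mod_cast hmn)) hv
  have hdist : ∀ n, ‖price vmax ρ T n h - u‖ ≤ priceBound vmax ρ := fun n =>
    abs_sub_le_of_nonneg_of_le (price_nonneg vmax ρ T n h) (hh.price_le hρ hρv n) hu.1 hu.2
  have hregret := sum_inner_le_of_norm_gradientStep_le (by simp) hweight hdist
    (g := fun n => gradient vmax ρ T n h) (fun n => abs_price_succ_sub_le hv.le hρ.le hu.1) T
  have hgradient := hh.sum_sq_gradient_div_le (T := T) hρ hρv
  have hsqrt := mul_le_mul_of_nonneg_left (sqrt_le_deviation hT)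
    (show 0 ≤ vmax * (priceBound vmax ρ ^ 2 / 2 + 2) by positivity)
  have hlog := mul_le_mul_of_nonneg_left (logLevel_le_two_mul_deviation (one_le_two.trans hT))
    (show 0 ≤ 6 * vmax by positivity)
  have hinner : ∀ n, inner ℝ (price vmax ρ T n h - u) (gradient vmax ρ T n h) =
      (price vmax ρ T n h - u) * gradient vmax ρ T n h := fun n => mul_comm _ _
  simp only [hinner] at hregret
  linarith

end DualDescent

section LagrangianDecomposition

variable (vmax ρ : ℝ) (T n : ℕ) (h : Path)

/-- Increment in round `n + 1`, at value `w`, of the martingale that compares the mean revenue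
`val` of the static rule `π` to its Lagrangian at the current price. Here `R w` and `C w` are the
mean revenue and payment at value `w`, and `κ` is the mean payment of `π`. -/
noncomputable def lagrangeGap (π R C : ℝ → ℝ) (val κ w : ℝ) : ℝ :=
  alive vmax ρ T n h * (val - π w * R w + price vmax ρ T n h * (π w * C w - κ))

/-- The empirical means stay within the confidence radius of `R` and `C`, and the three
martingales of the regret decomposition stay below `K`, `K` and `K'` after `T` rounds. -/
structure Concentrated (π R C : ℝ → ℝ) (val κ K K' : ℝ) : Prop where
  reward_mean : ∀ n ∈ Finset.Ico 1 T,
    |(∑ i ∈ Finset.range n, reward (h n).1 (h i).2) / n - R (h n).1| ≤ radius T n * (h n).1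
  cost_mean : ∀ n ∈ Finset.Ico 1 T,
    |(∑ i ∈ Finset.range n, cost (h n).1 (h i).2) / n - C (h n).1| ≤ radius T n * (h n).1
  sum_reward : ∑ n ∈ Finset.range T,
    choice vmax ρ T n h (h n).1 * (R (h n).1 - reward (h n).1 (h n).2) ≤ K
  sum_cost : ∑ n ∈ Finset.range T,
    choice vmax ρ T n h (h n).1 * (cost (h n).1 (h n).2 - C (h n).1) ≤ K
  sum_lagrangeGap : ∑ n ∈ Finset.range T, lagrangeGap vmax ρ T n h π R C val κ (h n).1 ≤ K'

variable {vmax ρ T n h}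

theorem mul_le_choice_mul (ha : alive vmax ρ T n h = 1) {q : ℝ} (hq : q ∈ Set.Icc (0 : ℝ) 1)
    (w : ℝ) :
    q * (rewardUCB T n h w - price vmax ρ T n h * costLCB T n h w) ≤
      choice vmax ρ T n h w * (rewardUCB T n h w - price vmax ρ T n h * costLCB T n h w) := by
  rw [choice, ha]
  split_ifs with hle
  · exact mul_le_mul_of_nonneg_right hq.2 (sub_nonneg.2 hle)
  · rw [zero_mul]
    exact mul_nonpos_of_nonneg_of_nonpos hq.1 (sub_nonpos.2 (not_le.1 hle).le)

variable {π R C : ℝ → ℝ} {val κ u δ : ℝ}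

theorem lagrangian_step (hκ : κ ≤ ρ) (hu : 0 ≤ u) (hδ : 0 ≤ δ)
    (hπ : π (h n).1 ∈ Set.Icc (0 : ℝ) 1)
    (hR : rewardUCB T n h (h n).1 ∈ Set.Icc (R (h n).1) (R (h n).1 + 2 * δ))
    (hC : costLCB T n h (h n).1 ∈ Set.Icc (C (h n).1 - 3 * δ) (C (h n).1)) :
    val * alive vmax ρ T n h - choice vmax ρ T n h (h n).1 * R (h n).1 ≤
      lagrangeGap vmax ρ T n h π R C val κ (h n).1 +
        (price vmax ρ T n h - u) * gradient vmax ρ T n h +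
        u * (ρ * alive vmax ρ T n h - choice vmax ρ T n h (h n).1 * C (h n).1) +
        (3 * u + 2) * δ := by
  rcases alive_eq_zero_or_one vmax ρ T n h with ha | ha
  · rw [lagrangeGap, gradient, choice_of_alive_eq_zero ha, ha]
    have : 0 ≤ (3 * u + 2) * δ := by positivity
    linarith
  have hmax := mul_le_choice_mul ha hπ (h n).1
  have hx := choice_mem_Icc vmax ρ T n h (h n).1
  rw [lagrangeGap, gradient, ha]
  set x := choice vmax ρ T n h (h n).1
  set lam := price vmax ρ T n h
  have hlam : 0 ≤ lam := price_nonneg vmax ρ T n h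
  have hoptimistic : π (h n).1 * (R (h n).1 - lam * C (h n).1) ≤
      π (h n).1 * (rewardUCB T n h (h n).1 - lam * costLCB T n h (h n).1) :=
    mul_le_mul_of_nonneg_left
      (sub_le_sub hR.1 (mul_le_mul_of_nonneg_left hC.2 hlam)) hπ.1
  have hreward : x * rewardUCB T n h (h n).1 - x * R (h n).1 ≤ 2 * δ := by
    rw [← mul_sub]
    exact (mul_le_of_le_one_left (sub_nonneg.2 hR.1) hx.2).trans (by linarith [hR.2])
  have hcost : u * (x * C (h n).1 - x * costLCB T n h (h n).1) ≤ u * (3 * δ) := by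
    rw [← mul_sub]
    exact mul_le_mul_of_nonneg_left
      ((mul_le_of_le_one_left (sub_nonneg.2 hC.2) hx.2).trans (by linarith [hC.1])) hu
  have hslack := mul_le_mul_of_nonneg_left hκ hlam
  linarith

theorem lagrangian_step_zero (hu : 0 ≤ u) (hπ : π (h 0).1 ≤ 1)
    (hR : 0 ≤ R (h 0).1) (hC : C (h 0).1 ≤ vmax) :
    val * alive vmax ρ T 0 h - choice vmax ρ T 0 h (h 0).1 * R (h 0).1 ≤
      lagrangeGap vmax ρ T 0 h π R C val κ (h 0).1 +
        (price vmax ρ T 0 h - u) * gradient vmax ρ T 0 h +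
        u * (ρ * alive vmax ρ T 0 h - choice vmax ρ T 0 h (h 0).1 * C (h 0).1) + u * vmax := by
  have hreward := mul_le_of_le_one_left hR hπ
  have hcost := mul_le_mul_of_nonneg_left hC hu
  rw [lagrangeGap, gradient_zero, choice_zero, alive_zero, price_zero]
  linarith

variable {K K' : ℝ}

theorem Concentrated.sum_lagrangian_le (hc : Concentrated vmax ρ T h π R C val κ K K')
    (hh : InBox vmax h) (hκ : κ ≤ ρ) (hu : 0 ≤ u)
    (hπ : ∀ w ∈ Set.Icc 0 vmax, π w ∈ Set.Icc (0 : ℝ) 1)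
    (hR : ∀ w ∈ Set.Icc 0 vmax, 0 ≤ R w) (hC : ∀ w ∈ Set.Icc 0 vmax, C w ≤ vmax) :
    ∑ n ∈ Finset.range T, (val * alive vmax ρ T n h - choice vmax ρ T n h (h n).1 * R (h n).1) ≤
      K' + ∑ n ∈ Finset.range T, (price vmax ρ T n h - u) * gradient vmax ρ T n h +
        u * ∑ n ∈ Finset.range T,
          (ρ * alive vmax ρ T n h - choice vmax ρ T n h (h n).1 * C (h n).1) +
        (3 * u + 2) * (vmax * (2 * deviation T)) + u * vmax := by
  have hv : 0 ≤ vmax := (hh 0).1.1.trans (hh 0).1.2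
  have hround : ∀ n ∈ Finset.range T,
      val * alive vmax ρ T n h - choice vmax ρ T n h (h n).1 * R (h n).1 ≤
      lagrangeGap vmax ρ T n h π R C val κ (h n).1 +
        (price vmax ρ T n h - u) * gradient vmax ρ T n h +
        u * (ρ * alive vmax ρ T n h - choice vmax ρ T n h (h n).1 * C (h n).1) +
        (3 * u + 2) * (vmax * radius T n) + if n = 0 then u * vmax else 0 := fun n hn => by
    have hw := (hh n).1
    rcases eq_or_ne n 0 with rfl | hn0
    · have := lagrangian_step_zero (ρ := ρ) (T := T) (val := val) (κ := κ) hu (hπ _ hw).2 (hR _ hw)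
        (hC _ hw)
      simpa [radius] using this
    · have hn1 : n ∈ Finset.Ico 1 T :=
        Finset.mem_Ico.2 ⟨Nat.one_le_iff_ne_zero.2 hn0, Finset.mem_range.1 hn⟩
      have hδ : radius T n * (h n).1 ≤ vmax * radius T n :=
        (mul_le_mul_of_nonneg_left hw.2 radius_nonneg).trans_eq (mul_comm _ _)
      have hreward := abs_le.1 (hc.reward_mean n hn1)
      have hcost := abs_le.1 (hc.cost_mean n hn1)
      rw [if_neg hn0, add_zero]
      refine lagrangian_step hκ hu (mul_nonneg hv radius_nonneg) (hπ _ hw) ?_ ?_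
      · rw [rewardUCB]
        constructor <;> linarith
      · rw [costLCB]
        constructor <;> linarith
  refine (Finset.sum_le_sum hround).trans ?_
  simp only [Finset.sum_add_distrib, ← Finset.mul_sum, Finset.sum_ite_eq', Finset.mem_range]
  have hradius := sum_radius_le (T := T)
  have hgap := hc.sum_lagrangeGap
  gcongr
  split_ifs
  exacts [le_rfl, mul_nonneg hu hv]

/-- Complementary slackness: the multiplier is `vmax / ρ` if the budget runs out before the last
round, and `0` otherwise. -/
theorem InBox.exists_multiplier (hh : InBox vmax h) (hρ : 0 < ρ) (hval : val ≤ vmax) :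
    ∃ u ∈ Set.Icc 0 (vmax / ρ), val * T ≤ ∑ n ∈ Finset.range T, val * alive vmax ρ T n h -
      u * (∑ n ∈ Finset.range T, ρ * alive vmax ρ T n h - spent vmax ρ T T h) + u * vmax := by
  have hv : 0 ≤ vmax := (hh 0).1.1.trans (hh 0).1.2
  have hmax : 0 ≤ vmax / ρ := div_nonneg hv hρ.le
  simp only [← Finset.mul_sum]
  by_cases hall : ∀ n ∈ Finset.range T, alive vmax ρ T n h = 1
  · refine ⟨0, ⟨le_rfl, hmax⟩, ?_⟩
    rw [Finset.sum_congr rfl hall]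
    simp
  push Not at hall
  obtain ⟨n, hn, ha⟩ := hall
  have hhalt := (alive_eq_zero_or_one vmax ρ T n h).resolve_right ha
  have hspent : ρ * T - spent vmax ρ T T h ≤ vmax :=
    (sub_le_sub_left (hh.monotone_spent (Finset.mem_range.1 hn).le) _).trans
      (hh.budget_lt_of_alive_eq_zero hhalt).le
  have halive : ∑ n ∈ Finset.range T, alive vmax ρ T n h ≤ T :=
    (Finset.sum_le_card_nsmul _ _ 1 fun n _ => (alive_mem_Icc vmax ρ T n h).2).trans_eq (by simp)
  refine ⟨vmax / ρ, ⟨hmax, le_rfl⟩, ?_⟩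
  have hcancel : vmax / ρ * ρ = vmax := div_mul_cancel₀ _ hρ.ne'
  calc val * T
      ≤ val * ∑ n ∈ Finset.range T, alive vmax ρ T n h +
          vmax * (T - ∑ n ∈ Finset.range T, alive vmax ρ T n h) := by
        linarith [mul_le_mul_of_nonneg_right hval (sub_nonneg.2 halive)]
    _ = val * ∑ n ∈ Finset.range T, alive vmax ρ T n h - vmax / ρ *
          (ρ * ∑ n ∈ Finset.range T, alive vmax ρ T n h - spent vmax ρ T T h) +
          vmax / ρ * (ρ * T - spent vmax ρ T T h) := by
        linear_combination (T - ∑ n ∈ Finset.range T, alive vmax ρ T n h) * -hcancel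
    _ ≤ _ := by gcongr

/-- The constant of the pathwise regret bound. -/
noncomputable def regretConst (vmax ρ : ℝ) : ℝ :=
  vmax * (priceBound vmax ρ ^ 2 / 2 + 12 * priceBound vmax ρ + 22)

theorem Concentrated.regret_le
    (hc : Concentrated vmax ρ T h π R C val κ (2 * vmax * deviation T)
      (2 * (vmax * (1 + priceBound vmax ρ)) * deviation T))
    (hh : InBox vmax h) (hρ : 0 < ρ) (hρv : ρ ≤ vmax) (hT : 2 ≤ T) (hκ : κ ≤ ρ) (hval : val ≤ vmax)
    (hπ : ∀ w ∈ Set.Icc 0 vmax, π w ∈ Set.Icc (0 : ℝ) 1)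
    (hR : ∀ w ∈ Set.Icc 0 vmax, 0 ≤ R w) (hC : ∀ w ∈ Set.Icc 0 vmax, C w ≤ vmax) :
    val * T - pathRevenue vmax ρ T h ≤ regretConst vmax ρ * deviation T := by
  have hv : 0 < vmax := hρ.trans_le hρv
  obtain ⟨u, ⟨hu, huρ⟩, hslack⟩ := hh.exists_multiplier (T := T) hρ hval
  have huM : u ≤ priceBound vmax ρ := huρ.trans (div_le_priceBound hρ hρv)
  have hlagrange := hc.sum_lagrangian_le hh hκ hu hπ hR hC
  have hdescent := hh.sum_sub_mul_gradient_le hρ hρv hT ⟨hu, huM⟩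
  have hreward := hc.sum_reward
  have hcost := mul_le_mul_of_nonneg_left hc.sum_cost hu
  simp only [mul_sub, Finset.sum_sub_distrib] at hreward hcost hlagrange
  rw [← pathRevenue_eq_sum_choice] at hreward
  have hfirst : u * vmax ≤ u * (vmax * deviation T) := by
    gcongr
    exact le_mul_of_one_le_right hv.le (one_le_deviation hT)
  have hbound : u * (vmax * deviation T) ≤ priceBound vmax ρ * (vmax * deviation T) :=
    mul_le_mul_of_nonneg_right huM (mul_nonneg hv.le (deviation_nonneg T))
  rw [spent] at hslack
  rw [regretConst]
  linarith

end LagrangianDecomposition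

theorem exp_neg_logLevel {T : ℕ} (hT : 1 ≤ T) :
    Real.exp (-logLevel T) = 1 / (2 * (T : ℝ) ^ 2) := by
  have : (0 : ℝ) < T := by exact_mod_cast hT
  have hlog : 2 * Real.log T = Real.log ((T : ℝ) ^ 2) := by simp
  rw [logLevel, hlog, ← Real.log_mul two_ne_zero (by positivity), Real.exp_neg,
    Real.exp_log (by positivity), one_div]

section SubgaussianTail

variable {Ω : Type*} [MeasurableSpace Ω] {μ : Measure Ω} [IsFiniteMeasure μ]
  {X : Ω → ℝ} {c : ℝ≥0}

theorem measureReal_lt_le_exp_neg (hX : HasSubgaussianMGF X c μ) {ε L : ℝ} (hε : 0 ≤ ε)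
    (hL : 2 * c * L ≤ ε ^ 2) : μ.real {ω | ε < X ω} ≤ Real.exp (-L) := by
  rcases eq_or_ne c 0 with rfl | hc
  · have hzero : μ {ω | ε < X ω} = 0 := by
      refine measure_eq_zero_iff_ae_notMem.2 ?_
      filter_upwards [hX.ae_eq_zero_of_hasSubgaussianMGF_zero] with ω hω
      simpa [hω] using hε
    rw [measureReal_def, hzero, ENNReal.toReal_zero]
    exact (Real.exp_pos _).le
  · have hc' : (0 : ℝ) < 2 * c := by positivity
    calc μ.real {ω | ε < X ω} ≤ μ.real {ω | ε ≤ X ω} :=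
          measureReal_mono fun ω (hω : ε < X ω) => hω.le
      _ ≤ Real.exp (-ε ^ 2 / (2 * c)) := hX.measure_ge_le hε
      _ ≤ Real.exp (-L) := by
        rw [neg_div]
        gcongr
        rwa [le_div_iff₀' hc']

theorem measureReal_lt_abs_le_two_mul_exp_neg (hX : HasSubgaussianMGF X c μ) {ε L : ℝ}
    (hε : 0 ≤ ε) (hL : 2 * c * L ≤ ε ^ 2) :
    μ.real {ω | ε < |X ω|} ≤ 2 * Real.exp (-L) := by
  calc μ.real {ω | ε < |X ω|} = μ.real ({ω | ε < X ω} ∪ {ω | ε < (-X) ω}) := by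
        congr 1
        ext ω
        simp [lt_abs]
    _ ≤ μ.real {ω | ε < X ω} + μ.real {ω | ε < (-X) ω} := measureReal_union_le _ _
    _ ≤ 2 * Real.exp (-L) := by
        rw [two_mul]
        exact add_le_add (measureReal_lt_le_exp_neg hX hε hL)
          (measureReal_lt_le_exp_neg hX.neg hε hL)

theorem measureReal_two_mul_deviation_lt_le {T : ℕ} (hT : 1 ≤ T) {b : ℝ} (hb : 0 ≤ b)
    (hX : HasSubgaussianMGF X (T * ‖b‖₊ ^ 2) μ) :
    μ.real {ω | 2 * b * deviation T < X ω} ≤ 1 / (2 * (T : ℝ) ^ 2) := by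
  rw [← exp_neg_logLevel hT]
  refine measureReal_lt_le_exp_neg hX (by have := deviation_nonneg T; positivity) ?_
  have := logLevel_nonneg T
  have hpos : 0 ≤ b ^ 2 * (T * logLevel T) := by positivity
  rw [mul_pow, mul_pow, sq_deviation]
  push_cast [coe_nnnorm, Real.norm_eq_abs, sq_abs]
  linarith

end SubgaussianTail

section BidMean

variable {vmax : ℝ} {F G : Measure ℝ} {f : ℝ → ℝ → ℝ} {w : ℝ}

/-- A measurable function of a value and a competing bid that lies between `0` and the value. -/
structure BoundedByValue (f : ℝ → ℝ → ℝ) : Prop where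
  measurable : Measurable fun z : ℝ × ℝ => f z.1 z.2
  mem_Icc : ∀ {w p : ℝ}, 0 ≤ w → 0 ≤ p → f w p ∈ Set.Icc 0 w

theorem boundedByValue_reward : BoundedByValue reward := ⟨measurable_reward, reward_mem_Icc⟩

theorem boundedByValue_cost : BoundedByValue cost := ⟨measurable_cost, cost_mem_Icc⟩

/-- Mean of `f w p` over the competing bid `p`. -/
noncomputable def bidMean (G : Measure ℝ) (f : ℝ → ℝ → ℝ) (w : ℝ) : ℝ := ∫ p, f w p ∂G

/-- Mean of `f` in a round that is entered with probability `g w` at value `w`. -/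
noncomputable def ruleMean (F G : Measure ℝ) (f : ℝ → ℝ → ℝ) (g : ℝ → ℝ) : ℝ :=
  ∫ z, g z.1 * f z.1 z.2 ∂F.prod G

theorem BoundedByValue.measurable_bidMean [SFinite G] (hf : BoundedByValue f) :
    Measurable (bidMean G f) :=
  hf.measurable.stronglyMeasurable.integral_prod_right.measurable

theorem BoundedByValue.measurable_right (hf : BoundedByValue f) (w : ℝ) : Measurable (f w) :=
  hf.measurable.comp (measurable_prodMk_left (x := w))

theorem BoundedByValue.ae_mem_Icc (hf : BoundedByValue f)
    (hG : ∀ᵐ x ∂G, x ∈ Set.Icc 0 vmax) (hw : 0 ≤ w) : ∀ᵐ p ∂G, f w p ∈ Set.Icc 0 w :=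
  hG.mono fun _ hp => hf.mem_Icc hw hp.1

theorem ae_prod_mem_Icc [SFinite F] [SFinite G] (hF : ∀ᵐ x ∂F, x ∈ Set.Icc 0 vmax)
    (hG : ∀ᵐ x ∂G, x ∈ Set.Icc 0 vmax) :
    ∀ᵐ z ∂F.prod G, z.1 ∈ Set.Icc 0 vmax ∧ z.2 ∈ Set.Icc 0 vmax :=
  (Measure.quasiMeasurePreserving_fst.ae hF).and (Measure.quasiMeasurePreserving_snd.ae hG)

variable [IsProbabilityMeasure G]

theorem BoundedByValue.integrable (hf : BoundedByValue f)
    (hG : ∀ᵐ x ∂G, x ∈ Set.Icc 0 vmax) (hw : 0 ≤ w) : Integrable (f w) G :=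
  .of_mem_Icc 0 w (hf.measurable_right w).aemeasurable (hf.ae_mem_Icc hG hw)

theorem BoundedByValue.bidMean_mem_Icc (hf : BoundedByValue f)
    (hG : ∀ᵐ x ∂G, x ∈ Set.Icc 0 vmax) (hw : 0 ≤ w) : bidMean G f w ∈ Set.Icc 0 w :=
  (convex_Icc 0 w).integral_mem isClosed_Icc (hf.ae_mem_Icc hG hw) (hf.integrable hG hw)

variable [IsProbabilityMeasure F] {g : ℝ → ℝ}

theorem BoundedByValue.ae_mul_mem_Icc (hf : BoundedByValue f)
    (hF : ∀ᵐ x ∂F, x ∈ Set.Icc 0 vmax) (hG : ∀ᵐ x ∂G, x ∈ Set.Icc 0 vmax)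
    (hg : ∀ w ∈ Set.Icc 0 vmax, g w ∈ Set.Icc (0 : ℝ) 1) :
    ∀ᵐ z ∂F.prod G, g z.1 * f z.1 z.2 ∈ Set.Icc 0 vmax := by
  filter_upwards [ae_prod_mem_Icc hF hG] with z hz
  have hfz := hf.mem_Icc hz.1.1 hz.2.1
  have hgz := hg _ hz.1
  exact ⟨mul_nonneg hgz.1 hfz.1, (mul_le_of_le_one_left hfz.1 hgz.2).trans (hfz.2.trans hz.1.2)⟩

theorem BoundedByValue.integrable_mul (hf : BoundedByValue f)
    (hF : ∀ᵐ x ∂F, x ∈ Set.Icc 0 vmax) (hG : ∀ᵐ x ∂G, x ∈ Set.Icc 0 vmax) (hgm : Measurable g)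
    (hg : ∀ w ∈ Set.Icc 0 vmax, g w ∈ Set.Icc (0 : ℝ) 1) :
    Integrable (fun z => g z.1 * f z.1 z.2) (F.prod G) :=
  .of_mem_Icc 0 vmax ((hgm.comp measurable_fst).mul hf.measurable).aemeasurable
    (hf.ae_mul_mem_Icc hF hG hg)

theorem BoundedByValue.ruleMean_mem_Icc (hf : BoundedByValue f)
    (hF : ∀ᵐ x ∂F, x ∈ Set.Icc 0 vmax) (hG : ∀ᵐ x ∂G, x ∈ Set.Icc 0 vmax) (hgm : Measurable g)
    (hg : ∀ w ∈ Set.Icc 0 vmax, g w ∈ Set.Icc (0 : ℝ) 1) :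
    ruleMean F G f g ∈ Set.Icc 0 vmax :=
  (convex_Icc 0 vmax).integral_mem isClosed_Icc (hf.ae_mul_mem_Icc hF hG hg)
    (hf.integrable_mul hF hG hgm hg)

theorem BoundedByValue.integrable_mul_bidMean (hf : BoundedByValue f)
    (hF : ∀ᵐ x ∂F, x ∈ Set.Icc 0 vmax) (hG : ∀ᵐ x ∂G, x ∈ Set.Icc 0 vmax) (hgm : Measurable g)
    (hg : ∀ w ∈ Set.Icc 0 vmax, g w ∈ Set.Icc (0 : ℝ) 1) :
    Integrable (fun w => g w * bidMean G f w) F := by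
  simpa only [bidMean, ← integral_const_mul] using
    (hf.integrable_mul hF hG hgm hg).integral_prod_left

theorem BoundedByValue.integral_mul_bidMean (hf : BoundedByValue f)
    (hF : ∀ᵐ x ∂F, x ∈ Set.Icc 0 vmax) (hG : ∀ᵐ x ∂G, x ∈ Set.Icc 0 vmax) (hgm : Measurable g)
    (hg : ∀ w ∈ Set.Icc 0 vmax, g w ∈ Set.Icc (0 : ℝ) 1) :
    ∫ z, g z.1 * bidMean G f z.1 ∂F.prod G = ruleMean F G f g := by
  rw [integral_fun_fst fun w => g w * bidMean G f w, probReal_univ, one_smul, ruleMean,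
    integral_prod _ (hf.integrable_mul hF hG hgm hg)]
  simp only [integral_const_mul, bidMean]

theorem BoundedByValue.integral_mul_sub_bidMean (hf : BoundedByValue f)
    (hF : ∀ᵐ x ∂F, x ∈ Set.Icc 0 vmax) (hG : ∀ᵐ x ∂G, x ∈ Set.Icc 0 vmax) (hgm : Measurable g)
    (hg : ∀ w ∈ Set.Icc 0 vmax, g w ∈ Set.Icc (0 : ℝ) 1) :
    ∫ z, g z.1 * (f z.1 z.2 - bidMean G f z.1) ∂F.prod G = 0 := by
  simp only [mul_sub]
  rw [integral_sub (hf.integrable_mul hF hG hgm hg)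
    ((hf.integrable_mul_bidMean hF hG hgm hg).comp_fst G),
    hf.integral_mul_bidMean hF hG hgm hg, ruleMean, sub_self]

end BidMean

section Concentration

variable {vmax ρ : ℝ} {T n : ℕ} {F G : Measure ℝ} [IsProbabilityMeasure F] [IsProbabilityMeasure G]
  {f : ℝ → ℝ → ℝ}

/-- Law of a path whose values are drawn from `F` and whose bids are drawn from `G`, all
independently. -/
noncomputable abbrev pathMeasure (F G : Measure ℝ) [IsProbabilityMeasure F]
    [IsProbabilityMeasure G] : Measure Path :=
  Measure.infinitePi fun _ => F.prod G

theorem ae_inBox (hF : ∀ᵐ x ∂F, x ∈ Set.Icc 0 vmax) (hG : ∀ᵐ x ∂G, x ∈ Set.Icc 0 vmax) :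
    ∀ᵐ h ∂pathMeasure F G, InBox vmax h :=
  ae_all_iff.2 fun n => (measurePreserving_eval_infinitePi (fun _ : ℕ => F.prod G) n)
    |>.quasiMeasurePreserving.ae (ae_prod_mem_Icc hF hG)

theorem hasSubgaussianMGF_sum_bid (hf : BoundedByValue f) (hG : ∀ᵐ x ∂G, x ∈ Set.Icc 0 vmax)
    {w : ℝ} (hw : 0 ≤ w) (n : ℕ) :
    HasSubgaussianMGF (fun h => ∑ i ∈ Finset.range n, (f w (h i).2 - bidMean G f w))
      (n * (‖w‖₊ / 2) ^ 2) (pathMeasure F G) := by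
  have hbid : HasSubgaussianMGF (fun z : ℝ × ℝ => f w z.2 - bidMean G f w) ((‖w‖₊ / 2) ^ 2)
      (F.prod G) := by
    have hmean : ∫ z, f w z.2 ∂F.prod G = bidMean G f w := by
      rw [integral_fun_snd (f w), probReal_univ, one_smul, bidMean]
    rw [← hmean]
    simpa only [sub_zero, Function.comp_apply] using hasSubgaussianMGF_of_mem_Icc
      ((hf.measurable_right w).comp measurable_snd).aemeasurable
      (Measure.quasiMeasurePreserving_snd.ae (hf.ae_mem_Icc hG hw))
  have hsum := hasSubgaussianMGF_sum_of_dependsOn (ν := fun _ : ℕ => F.prod G)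
    (D := fun _ _ z => f w z.2 - bidMean G f w) (c := fun _ => (‖w‖₊ / 2) ^ 2)
    (s := Finset.range n)
    (fun _ _ => ((hf.measurable_right w).comp
      (measurable_snd.comp measurable_snd)).sub_const _)
    (fun _ _ _ _ _ => rfl) (fun _ _ => ae_of_all _ fun _ => hbid)
  simpa using hsum

theorem measureReal_radius_lt_abs_sub_bidMean_le (hf : BoundedByValue f)
    (hG : ∀ᵐ x ∂G, x ∈ Set.Icc 0 vmax) (hT : 1 ≤ T) (hn : n ≠ 0) {w : ℝ} (hw : 0 ≤ w) :
    (pathMeasure F G).real {h | radius T n * w <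
      |(∑ i ∈ Finset.range n, f w (h i).2) / n - bidMean G f w|} ≤ 1 / (T : ℝ) ^ 2 := by
  have hn' : (0 : ℝ) < n := by positivity
  have hset : {h : Path | radius T n * w <
      |(∑ i ∈ Finset.range n, f w (h i).2) / n - bidMean G f w|} =
      {h | n * (radius T n * w) < |∑ i ∈ Finset.range n, (f w (h i).2 - bidMean G f w)|} := by
    ext h
    have hmul : ∑ i ∈ Finset.range n, (f w (h i).2 - bidMean G f w) =
        n * ((∑ i ∈ Finset.range n, f w (h i).2) / n - bidMean G f w) := by
      rw [mul_sub, mul_div_cancel₀ _ hn'.ne', Finset.sum_sub_distrib]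
      simp
    rw [Set.mem_ofPred_eq, Set.mem_ofPred_eq, hmul, abs_mul, abs_of_pos hn',
      mul_lt_mul_iff_right₀ hn']
  have hexp : 2 * Real.exp (-logLevel T) = 1 / (T : ℝ) ^ 2 := by
    rw [exp_neg_logLevel hT]
    field_simp
  rw [hset, ← hexp]
  refine measureReal_lt_abs_le_two_mul_exp_neg (hasSubgaussianMGF_sum_bid hf hG hw n)
    (mul_nonneg hn'.le (mul_nonneg radius_nonneg hw)) (le_of_eq ?_)
  rw [mul_pow, mul_pow, sq_radius]
  push_cast [coe_nnnorm, Real.norm_eq_abs, sq_abs, div_pow]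
  field_simp

theorem measureReal_estimate_error_le (hf : BoundedByValue f)
    (hF : ∀ᵐ x ∂F, x ∈ Set.Icc 0 vmax) (hG : ∀ᵐ x ∂G, x ∈ Set.Icc 0 vmax) (hT : 1 ≤ T)
    (hn : n ≠ 0) :
    (pathMeasure F G).real {h | radius T n * (h n).1 <
      |(∑ i ∈ Finset.range n, f (h n).1 (h i).2) / n - bidMean G f (h n).1|} ≤
        1 / (T : ℝ) ^ 2 := by
  refine ENNReal.toReal_le_of_le_ofReal (by positivity) ?_
  refine measure_le_of_dependsOn_compl (ν := fun _ : ℕ => F.prod G) (B := fun h z =>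
    radius T n * z.1 < |(∑ i ∈ Finset.range n, f z.1 (h i).2) / n - bidMean G f z.1|) ?_ ?_ ?_
  · have hbid (i : ℕ) : Measurable fun q : Path × ℝ × ℝ => f q.2.1 (q.1 i).2 :=
      hf.measurable.comp (f := fun q : Path × ℝ × ℝ => (q.2.1, (q.1 i).2)) (by fun_prop)
    have hmean : Measurable fun q : Path × ℝ × ℝ => bidMean G f q.2.1 :=
      hf.measurable_bidMean.comp measurable_snd.fst
    exact measurableSet_lt (by fun_prop)
      (((Finset.measurable_sum _ fun i _ => hbid i).div_const _).sub hmean).abs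
  · intro h h' hhh'
    have hne : ∀ i ∈ Finset.range n, h i = h' i := fun i hi => hhh' i (Finset.mem_range.1 hi).ne
    funext z
    simp only [Finset.sum_congr rfl fun i hi => congrArg (fun y : ℝ × ℝ => f z.1 y.2) (hne i hi)]
  · filter_upwards [Measure.quasiMeasurePreserving_fst.ae hF] with z hz
    rw [← ENNReal.ofReal_toReal (measure_ne_top _ _)]
    exact ENNReal.ofReal_le_ofReal (measureReal_radius_lt_abs_sub_bidMean_le hf hG hT hn hz.1)

theorem hasSubgaussianMGF_sum_choice_mul (hf : BoundedByValue f)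
    (hF : ∀ᵐ x ∂F, x ∈ Set.Icc 0 vmax) (hG : ∀ᵐ x ∂G, x ∈ Set.Icc 0 vmax) (hv : 0 ≤ vmax)
    (hρ : 0 ≤ ρ) :
    HasSubgaussianMGF (fun h => ∑ n ∈ Finset.range T, choice vmax ρ T n h (h n).1 *
      (f (h n).1 (h n).2 - bidMean G f (h n).1)) (T * ‖vmax‖₊ ^ 2) (pathMeasure F G) := by
  have hcard : (T * ‖vmax‖₊ ^ 2 : ℝ≥0) = (Finset.range T).card * ‖vmax‖₊ ^ 2 := by
    rw [Finset.card_range]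
  rw [hcard]
  refine hasSubgaussianMGF_sum_of_ae_abs_le (ν := fun _ : ℕ => F.prod G)
    (D := fun n h z => choice vmax ρ T n h z.1 * (f z.1 z.2 - bidMean G f z.1))
    (fun n _ => ?_) (fun n _ h h' hhh' => ?_) (fun n _ => ae_of_all _ fun h => ?_)
    (fun n _ => ae_of_all _ fun h => ?_)
  · have hx := measurable_choice (T := T) (n := n) hv hρ
    have hmean := hf.measurable_bidMean (G := G)
    exact (hx.comp (measurable_fst.prodMk measurable_snd.fst)).mul
      ((hf.measurable.comp measurable_snd).sub (hmean.comp measurable_snd.fst))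
  · simp only [dependsOn_choice hv hρ hhh']
  · filter_upwards [ae_prod_mem_Icc hF hG] with z hz
    have hx := choice_mem_Icc vmax ρ T n h z.1
    have hdiff : |f z.1 z.2 - bidMean G f z.1| ≤ vmax :=
      (abs_sub_le_of_nonneg_of_le (hf.mem_Icc hz.1.1 hz.2.1).1 (hf.mem_Icc hz.1.1 hz.2.1).2
        (hf.bidMean_mem_Icc hG hz.1.1).1 (hf.bidMean_mem_Icc hG hz.1.1).2).trans hz.1.2
    rw [abs_mul, abs_of_nonneg hx.1]
    exact (mul_le_of_le_one_left (abs_nonneg _) hx.2).trans hdiff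
  · exact hf.integral_mul_sub_bidMean hF hG
      ((measurable_choice hv hρ).comp measurable_prodMk_left)
      fun w _ => choice_mem_Icc vmax ρ T n h w

theorem InBox.abs_lagrangeGap_le {h : Path} (hh : InBox vmax h) (hρ : 0 < ρ) (hρv : ρ ≤ vmax)
    {π R C : ℝ → ℝ} {val κ w : ℝ} (hval : val ∈ Set.Icc 0 vmax) (hκ : κ ∈ Set.Icc 0 vmax)
    (hπR : π w * R w ∈ Set.Icc 0 vmax) (hπC : π w * C w ∈ Set.Icc 0 vmax) :
    |lagrangeGap vmax ρ T n h π R C val κ w| ≤ vmax * (1 + priceBound vmax ρ) := by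
  have ha := alive_mem_Icc vmax ρ T n h
  have hprice := price_nonneg vmax ρ T n h
  have hreward := abs_sub_le_of_nonneg_of_le hval.1 hval.2 hπR.1 hπR.2
  have hcost := abs_sub_le_of_nonneg_of_le hπC.1 hπC.2 hκ.1 hκ.2
  have hpriceCost : |price vmax ρ T n h * (π w * C w - κ)| ≤ priceBound vmax ρ * vmax := by
    rw [abs_mul, abs_of_nonneg hprice]
    exact mul_le_mul (hh.price_le hρ hρv n) hcost (abs_nonneg _)
      (hprice.trans (hh.price_le hρ hρv n))
  rw [lagrangeGap, abs_mul, abs_of_nonneg ha.1]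
  calc alive vmax ρ T n h * |val - π w * R w + price vmax ρ T n h * (π w * C w - κ)|
      ≤ |val - π w * R w + price vmax ρ T n h * (π w * C w - κ)| :=
        mul_le_of_le_one_left (abs_nonneg _) ha.2
    _ ≤ vmax + priceBound vmax ρ * vmax :=
        (abs_add_le _ _).trans (add_le_add hreward hpriceCost)
    _ = vmax * (1 + priceBound vmax ρ) := by ring

variable {π : ℝ → ℝ}

theorem integral_lagrangeGap (hF : ∀ᵐ x ∂F, x ∈ Set.Icc 0 vmax)
    (hG : ∀ᵐ x ∂G, x ∈ Set.Icc 0 vmax) (hπm : Measurable π)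
    (hπ : ∀ w ∈ Set.Icc 0 vmax, π w ∈ Set.Icc (0 : ℝ) 1) (h : Path) :
    ∫ z, lagrangeGap vmax ρ T n h π (bidMean G reward) (bidMean G cost)
      (ruleMean F G reward π) (ruleMean F G cost π) z.1 ∂F.prod G = 0 := by
  have hreward := (boundedByValue_reward.integrable_mul_bidMean hF hG hπm hπ).comp_fst G
  have hcost := (boundedByValue_cost.integrable_mul_bidMean hF hG hπm hπ).comp_fst G
  have hrewardGap : Integrable (fun z => ruleMean F G reward π - π z.1 * bidMean G reward z.1)
      (F.prod G) := (integrable_const _).sub hreward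
  have hcostGap : Integrable (fun z => π z.1 * bidMean G cost z.1 - ruleMean F G cost π)
      (F.prod G) := hcost.sub (integrable_const _)
  simp only [lagrangeGap]
  rw [integral_const_mul, integral_add hrewardGap (hcostGap.const_mul _), integral_const_mul,
    integral_sub (integrable_const _) hreward, integral_sub hcost (integrable_const _),
    boundedByValue_reward.integral_mul_bidMean hF hG hπm hπ,
    boundedByValue_cost.integral_mul_bidMean hF hG hπm hπ]
  simp

theorem hasSubgaussianMGF_sum_lagrangeGap (hF : ∀ᵐ x ∂F, x ∈ Set.Icc 0 vmax)
    (hG : ∀ᵐ x ∂G, x ∈ Set.Icc 0 vmax) (hρ : 0 < ρ) (hρv : ρ ≤ vmax) (hπm : Measurable π)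
    (hπ : ∀ w ∈ Set.Icc 0 vmax, π w ∈ Set.Icc (0 : ℝ) 1) :
    HasSubgaussianMGF (fun h => ∑ n ∈ Finset.range T, lagrangeGap vmax ρ T n h π
        (bidMean G reward) (bidMean G cost) (ruleMean F G reward π) (ruleMean F G cost π) (h n).1)
      (T * ‖vmax * (1 + priceBound vmax ρ)‖₊ ^ 2) (pathMeasure F G) := by
  have hv : 0 ≤ vmax := hρ.le.trans hρv
  have hcard : (T * ‖vmax * (1 + priceBound vmax ρ)‖₊ ^ 2 : ℝ≥0) =
      (Finset.range T).card * ‖vmax * (1 + priceBound vmax ρ)‖₊ ^ 2 := by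
    rw [Finset.card_range]
  rw [hcard]
  refine hasSubgaussianMGF_sum_of_ae_abs_le (ν := fun _ : ℕ => F.prod G)
    (D := fun n h z => lagrangeGap vmax ρ T n h π (bidMean G reward) (bidMean G cost)
      (ruleMean F G reward π) (ruleMean F G cost π) z.1)
    (fun n _ => ?_) (fun n _ h h' hhh' => ?_) (fun n _ => ?_)
    (fun n _ => ae_of_all _ (integral_lagrangeGap hF hG hπm hπ))
  · have ha := measurable_alive (T := T) (n := n) hv hρ.le
    have hp := measurable_price (T := T) (n := n) hv hρ.le
    have hR := boundedByValue_reward.measurable_bidMean (G := G)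
    have hC := boundedByValue_cost.measurable_bidMean (G := G)
    unfold lagrangeGap Function.uncurry
    fun_prop
  · simp only [lagrangeGap, dependsOn_alive hv hρ.le hhh', dependsOn_price hv hρ.le hhh']
  · filter_upwards [ae_inBox hF hG] with h hh
    filter_upwards [Measure.quasiMeasurePreserving_fst.ae hF] with z hz
    have hmul {m : ℝ} (hm : m ∈ Set.Icc 0 z.1) : π z.1 * m ∈ Set.Icc 0 vmax :=
      ⟨mul_nonneg (hπ _ hz).1 hm.1,
        (mul_le_of_le_one_left hm.1 (hπ _ hz).2).trans (hm.2.trans hz.2)⟩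
    exact hh.abs_lagrangeGap_le hρ hρv
      (boundedByValue_reward.ruleMean_mem_Icc hF hG hπm hπ)
      (boundedByValue_cost.ruleMean_mem_Icc hF hG hπm hπ)
      (hmul (boundedByValue_reward.bidMean_mem_Icc hG hz.1))
      (hmul (boundedByValue_cost.bidMean_mem_Icc hG hz.1))

theorem measureReal_exists_estimate_error_le (hf : BoundedByValue f)
    (hF : ∀ᵐ x ∂F, x ∈ Set.Icc 0 vmax) (hG : ∀ᵐ x ∂G, x ∈ Set.Icc 0 vmax) (hT : 1 ≤ T) :
    (pathMeasure F G).real (⋃ n ∈ Finset.Ico 1 T, {h | radius T n * (h n).1 <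
      |(∑ i ∈ Finset.range n, f (h n).1 (h i).2) / n - bidMean G f (h n).1|}) ≤
        (T - 1) / (T : ℝ) ^ 2 :=
  calc _ ≤ ∑ n ∈ Finset.Ico 1 T, (pathMeasure F G).real {h | radius T n * (h n).1 <
        |(∑ i ∈ Finset.range n, f (h n).1 (h i).2) / n - bidMean G f (h n).1|} :=
        measureReal_biUnion_finset_le _ _
    _ ≤ ∑ _n ∈ Finset.Ico 1 T, 1 / (T : ℝ) ^ 2 :=
        Finset.sum_le_sum fun n hn => measureReal_estimate_error_le hf hF hG hT
          (Nat.one_le_iff_ne_zero.1 (Finset.mem_Ico.1 hn).1)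
    _ = (T - 1) / (T : ℝ) ^ 2 := by
        rw [Finset.sum_const, Nat.card_Ico, nsmul_eq_mul, Nat.cast_sub hT, Nat.cast_one,
          mul_one_div]

theorem measureReal_not_concentrated_le (hF : ∀ᵐ x ∂F, x ∈ Set.Icc 0 vmax)
    (hG : ∀ᵐ x ∂G, x ∈ Set.Icc 0 vmax) (hρ : 0 < ρ) (hρv : ρ ≤ vmax) (hT : 1 ≤ T)
    (hπm : Measurable π) (hπ : ∀ w ∈ Set.Icc 0 vmax, π w ∈ Set.Icc (0 : ℝ) 1) :
    (pathMeasure F G).real {h | ¬Concentrated vmax ρ T h π (bidMean G reward) (bidMean G cost)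
      (ruleMean F G reward π) (ruleMean F G cost π) (2 * vmax * deviation T)
      (2 * (vmax * (1 + priceBound vmax ρ)) * deviation T)} ≤ 2 / T := by
  have hv : 0 ≤ vmax := hρ.le.trans hρv
  have hb : 0 ≤ vmax * (1 + priceBound vmax ρ) := by
    unfold priceBound
    positivity
  have hRewardMean := measureReal_exists_estimate_error_le boundedByValue_reward hF hG hT
  have hCostMean := measureReal_exists_estimate_error_le boundedByValue_cost hF hG hT
  have hReward := measureReal_two_mul_deviation_lt_le hT hv
    (hasSubgaussianMGF_sum_choice_mul (T := T) boundedByValue_reward hF hG hv hρ.le).neg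
  have hCost := measureReal_two_mul_deviation_lt_le hT hv
    (hasSubgaussianMGF_sum_choice_mul (T := T) boundedByValue_cost hF hG hv hρ.le)
  have hGap := measureReal_two_mul_deviation_lt_le hT hb
    (hasSubgaussianMGF_sum_lagrangeGap (T := T) hF hG hρ hρv hπm hπ)
  have hTpos : (0 : ℝ) < T := by exact_mod_cast hT
  refine (measureReal_mono fun h hh => ?_).trans
    ((measureReal_union_le _ _).trans (add_le_add (measureReal_union_le _ _ |>.trans
      (add_le_add hRewardMean hCostMean)) ((measureReal_union_le _ _).trans
      (add_le_add hReward ((measureReal_union_le _ _).trans (add_le_add hCost hGap)))))) |>.trans ?_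
  · contrapose! hh
    simp only [Set.mem_union, Set.mem_iUnion, Set.mem_ofPred_eq, Pi.neg_apply, not_or, not_exists,
      not_lt] at hh
    obtain ⟨⟨hRewardMean, hCostMean⟩, hReward, hCost, hGap⟩ := hh
    refine not_not.2 ⟨hRewardMean, hCostMean, ?_, hCost, hGap⟩
    simpa only [← Finset.sum_neg_distrib, ← mul_neg, neg_sub] using hReward
  · have hsq : (T : ℝ) - 1 + (T - 1) + (1 / 2 + (1 / 2 + 1 / 2)) ≤ 2 * T := by linarith
    calc _ = ((T : ℝ) - 1 + (T - 1) + (1 / 2 + (1 / 2 + 1 / 2))) / T ^ 2 := by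
          field_simp
      _ ≤ 2 * T / T ^ 2 := by gcongr
      _ = 2 / T := by rw [sq, mul_div_mul_right _ _ hTpos.ne']

end Concentration

section Benchmark

variable {vmax ρ : ℝ} {T : ℕ} {F G : Measure ℝ}

theorem feasible_zero (hρ : 0 ≤ ρ) : Feasible vmax ρ F G fun _ => 0 :=
  ⟨measurable_const, fun _ _ => ⟨le_rfl, zero_le_one⟩, by simpa using hρ⟩

theorem exists_feasible_OPT_le (hρ : 0 ≤ ρ) (hT : 1 ≤ T) :
    ∃ π, Feasible vmax ρ F G π ∧ OPT vmax ρ T F G ≤ ruleMean F G reward π * T + 1 := by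
  have hT' : (0 : ℝ) < T := by exact_mod_cast hT
  obtain ⟨_, ⟨π, hπ, rfl⟩, hlt⟩ := exists_lt_of_lt_csSup
    (s := {R : ℝ | ∃ π : ℝ → ℝ, Feasible vmax ρ F G π ∧ R = ruleMean F G reward π})
    ⟨_, _, feasible_zero hρ, rfl⟩ (sub_lt_self _ (one_div_pos.2 hT'))
  refine ⟨π, hπ, ?_⟩
  have hmul := mul_le_mul_of_nonneg_left hlt.le hT'.le
  rw [mul_sub, mul_one_div_cancel hT'.ne'] at hmul
  unfold OPT
  unfold ruleMean at hmul ⊢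
  linarith

variable [IsProbabilityMeasure F] [IsProbabilityMeasure G]

theorem OPT_le_mul_integral_reward (hρ : 0 ≤ ρ) (hF : ∀ᵐ x ∂F, x ∈ Set.Icc 0 vmax)
    (hG : ∀ᵐ x ∂G, x ∈ Set.Icc 0 vmax) :
    OPT vmax ρ T F G ≤ T * ∫ z, reward z.1 z.2 ∂F.prod G := by
  refine mul_le_mul_of_nonneg_left (csSup_le ⟨_, _, feasible_zero hρ, rfl⟩ ?_) (Nat.cast_nonneg T)
  rintro _ ⟨π, hπ, rfl⟩
  have hone : Integrable (fun z : ℝ × ℝ => reward z.1 z.2) (F.prod G) := by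
    simpa only [one_mul] using boundedByValue_reward.integrable_mul hF hG (g := fun _ => 1)
      measurable_const fun _ _ => ⟨zero_le_one, le_rfl⟩
  refine integral_mono_ae
    (boundedByValue_reward.integrable_mul hF hG hπ.measurable hπ.mem_unit) hone ?_
  filter_upwards [ae_prod_mem_Icc hF hG] with z hz
  exact mul_le_of_le_one_left (reward_mem_Icc hz.1.1 hz.2.1).1 (hπ.mem_unit _ hz.1).2

theorem integral_reward_le (hF : ∀ᵐ x ∂F, x ∈ Set.Icc 0 vmax) (hG : ∀ᵐ x ∂G, x ∈ Set.Icc 0 vmax) :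
    ∫ z, reward z.1 z.2 ∂F.prod G ≤ vmax := by
  simpa only [ruleMean, one_mul] using (boundedByValue_reward.ruleMean_mem_Icc hF hG
    (g := fun _ => 1) measurable_const fun _ _ => ⟨zero_le_one, le_rfl⟩).2

theorem OPT_le (hρ : 0 ≤ ρ) (hF : ∀ᵐ x ∂F, x ∈ Set.Icc 0 vmax)
    (hG : ∀ᵐ x ∂G, x ∈ Set.Icc 0 vmax) : OPT vmax ρ T F G ≤ T * vmax :=
  (OPT_le_mul_integral_reward hρ hF hG).trans
    (mul_le_mul_of_nonneg_left (integral_reward_le hF hG) (Nat.cast_nonneg T))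

end Benchmark

section PathRegret

variable {vmax ρ : ℝ} {T : ℕ} {F G : Measure ℝ} {h : Path}

theorem regretConst_nonneg (hρ : 0 ≤ ρ) (hρv : ρ ≤ vmax) : 0 ≤ regretConst vmax ρ := by
  have hv : 0 ≤ vmax := hρ.trans hρv
  unfold regretConst priceBound
  positivity

/-- The constant `C` of the theorem. -/
noncomputable def regretRate (vmax ρ : ℝ) : ℝ := 2 * (regretConst vmax ρ + 1 + 2 * vmax)

theorem regretRate_pos (hρ : 0 ≤ ρ) (hρv : ρ ≤ vmax) : 0 < regretRate vmax ρ := by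
  have hv : 0 ≤ vmax := hρ.trans hρv
  have hconst := regretConst_nonneg hρ hρv
  unfold regretRate
  positivity

theorem deviation_le_two_mul_sqrt (hT : 2 ≤ T) :
    deviation T ≤ 2 * √(T * Real.log T) := by
  have hT' : (2 : ℝ) ≤ T := by exact_mod_cast hT
  have hlevel : logLevel T ≤ 2 ^ 2 * Real.log T := by
    rw [logLevel]
    linarith [Real.log_le_log two_pos hT', Real.log_nonneg (one_le_two.trans hT')]
  calc deviation T ≤ √(2 ^ 2 * (T * Real.log T)) := by
        refine Real.sqrt_le_sqrt ?_
        rw [mul_left_comm]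
        gcongr
    _ = 2 * √(T * Real.log T) := by
        rw [Real.sqrt_mul (by positivity), Real.sqrt_sq zero_le_two]

theorem add_mul_deviation_le (hρ : 0 ≤ ρ) (hρv : ρ ≤ vmax) (hT : 2 ≤ T) :
    (regretConst vmax ρ + 1) * deviation T + 2 * vmax ≤
      regretRate vmax ρ * √(T * Real.log T) := by
  have hv : 0 ≤ vmax := hρ.trans hρv
  have hconst := regretConst_nonneg hρ hρv
  calc (regretConst vmax ρ + 1) * deviation T + 2 * vmax
      ≤ (regretConst vmax ρ + 1) * deviation T + 2 * vmax * deviation T :=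
        add_le_add_right (le_mul_of_one_le_right (by positivity) (one_le_deviation hT)) _
    _ = (regretConst vmax ρ + 1 + 2 * vmax) * deviation T := by ring
    _ ≤ (regretConst vmax ρ + 1 + 2 * vmax) * (2 * √(T * Real.log T)) := by
        gcongr
        exact deviation_le_two_mul_sqrt hT
    _ = regretRate vmax ρ * √(T * Real.log T) := by
        rw [regretRate]
        ring

theorem integral_le_add_measureReal_mul {Ω : Type*} [MeasurableSpace Ω] {μ : Measure Ω}
    [IsProbabilityMeasure μ] {X : Ω → ℝ} (hX : Measurable X) (hint : Integrable X μ) {b M : ℝ}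
    (hb : 0 ≤ b) (hM : ∀ᵐ ω ∂μ, X ω ≤ M) : ∫ ω, X ω ∂μ ≤ b + μ.real {ω | b < X ω} * M := by
  have hset : MeasurableSet {ω | b < X ω} := measurableSet_lt measurable_const hX
  have htail : Integrable ({ω | b < X ω}.indicator fun _ => M) μ :=
    (integrable_const M).indicator hset
  calc ∫ ω, X ω ∂μ ≤ ∫ ω, b + {ω | b < X ω}.indicator (fun _ => M) ω ∂μ := by
        refine integral_mono_ae hint ((integrable_const b).add htail) ?_
        filter_upwards [hM] with ω hω
        by_cases hlt : b < X ω
        · simpa [hlt] using hω.trans (le_add_of_nonneg_left hb)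
        · simpa [hlt] using not_lt.1 hlt
    _ = b + μ.real {ω | b < X ω} * M := by
        rw [integral_add (integrable_const b) htail, integral_indicator_const _ hset]
        simp

theorem InBox.pathRevenue_mem_Icc (hh : InBox vmax h) :
    pathRevenue vmax ρ T h ∈ Set.Icc 0 (T * vmax) := by
  have hround (n : ℕ) :
      choice vmax ρ T n h (h n).1 * reward (h n).1 (h n).2 ∈ Set.Icc 0 vmax := by
    have hx := choice_mem_Icc vmax ρ T n h (h n).1
    have hr := reward_mem_Icc (hh n).1.1 (hh n).2.1
    exact ⟨mul_nonneg hx.1 hr.1,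
      (mul_le_of_le_one_left hr.1 hx.2).trans (hr.2.trans (hh n).1.2)⟩
  rw [pathRevenue_eq_sum_choice]
  exact ⟨Finset.sum_nonneg fun n _ => (hround n).1,
    (Finset.sum_le_sum fun n _ => (hround n).2).trans (by simp)⟩

theorem measurable_pathRevenue (hv : 0 ≤ vmax) (hρ : 0 ≤ ρ) :
    Measurable (pathRevenue vmax ρ T) := by
  have hround (n : ℕ) : Measurable fun h : Path =>
      choice vmax ρ T n h (h n).1 * reward (h n).1 (h n).2 :=
    ((measurable_choice hv hρ).comp (measurable_id.prodMk (measurable_pi_apply n).fst)).mul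
      (measurable_reward.comp (measurable_pi_apply n))
  simpa only [← pathRevenue_eq_sum_choice] using
    Finset.measurable_sum (Finset.range T) fun n _ => hround n

/-- Regret of OGD-CB along the path. -/
noncomputable def pathRegret (vmax ρ : ℝ) (T : ℕ) (F G : Measure ℝ) (h : Path) : ℝ :=
  OPT vmax ρ T F G - pathRevenue vmax ρ T h

theorem measurable_pathRegret (hv : 0 ≤ vmax) (hρ : 0 ≤ ρ) :
    Measurable (pathRegret vmax ρ T F G) :=
  (measurable_pathRevenue hv hρ).const_sub _

variable [IsProbabilityMeasure F] [IsProbabilityMeasure G]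

theorem integrable_pathRegret (hF : ∀ᵐ x ∂F, x ∈ Set.Icc 0 vmax)
    (hG : ∀ᵐ x ∂G, x ∈ Set.Icc 0 vmax) (hv : 0 ≤ vmax) (hρ : 0 ≤ ρ) :
    Integrable (pathRegret vmax ρ T F G) (pathMeasure F G) :=
  (integrable_const _).sub <| .of_mem_Icc 0 (T * vmax) (measurable_pathRevenue hv hρ).aemeasurable
    ((ae_inBox hF hG).mono fun _ hh => hh.pathRevenue_mem_Icc)

theorem measureReal_lt_pathRegret_le (hF : ∀ᵐ x ∂F, x ∈ Set.Icc 0 vmax)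
    (hG : ∀ᵐ x ∂G, x ∈ Set.Icc 0 vmax) (hρ : 0 < ρ) (hρv : ρ ≤ vmax) (hT : 2 ≤ T) :
    (pathMeasure F G).real {h | (regretConst vmax ρ + 1) * deviation T <
      pathRegret vmax ρ T F G h} ≤ 2 / T := by
  obtain ⟨π, hπ, hopt⟩ := exists_feasible_OPT_le (vmax := vmax) (F := F) (G := G) hρ.le
    (one_le_two.trans hT)
  refine le_trans (ENNReal.toReal_mono (measure_ne_top _ _) (measure_mono_ae ?_))
    (measureReal_not_concentrated_le hF hG hρ hρv (one_le_two.trans hT) hπ.measurable hπ.mem_unit)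
  filter_upwards [ae_inBox hF hG] with h hh hlt hc
  have hregret := hc.regret_le hh hρ hρv hT hπ.cost_le
    (boundedByValue_reward.ruleMean_mem_Icc hF hG hπ.measurable hπ.mem_unit).2 hπ.mem_unit
    (fun w hw => (boundedByValue_reward.bidMean_mem_Icc hG hw.1).1)
    fun w hw => (boundedByValue_cost.bidMean_mem_Icc hG hw.1).2.trans hw.2
  have hlt' : (regretConst vmax ρ + 1) * deviation T <
    OPT vmax ρ T F G - pathRevenue vmax ρ T h := hlt
  linarith [one_le_deviation hT]

theorem le_measureReal_pathRegret_le (hF : ∀ᵐ x ∂F, x ∈ Set.Icc 0 vmax)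
    (hG : ∀ᵐ x ∂G, x ∈ Set.Icc 0 vmax) (hρ : 0 < ρ) (hρv : ρ ≤ vmax) (hT : 1 ≤ T) :
    1 - 4 / (T : ℝ) ≤ (pathMeasure F G).real
      {h | pathRegret vmax ρ T F G h ≤ regretRate vmax ρ * √(T * Real.log T)} := by
  obtain rfl | hT2 : T = 1 ∨ 2 ≤ T := by omega
  · exact le_trans (by norm_num) measureReal_nonneg
  have hv : 0 ≤ vmax := hρ.le.trans hρv
  have hset : MeasurableSet {h : Path |
      (regretConst vmax ρ + 1) * deviation T < pathRegret vmax ρ T F G h} :=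
    measurableSet_lt measurable_const (measurable_pathRegret hv hρ.le)
  calc 1 - 4 / (T : ℝ) ≤ 1 - 2 / T := by
        gcongr
        norm_num
    _ ≤ 1 - (pathMeasure F G).real {h | (regretConst vmax ρ + 1) * deviation T <
        pathRegret vmax ρ T F G h} :=
        sub_le_sub_left (measureReal_lt_pathRegret_le hF hG hρ hρv hT2) _
    _ = (pathMeasure F G).real {h | (regretConst vmax ρ + 1) * deviation T <
        pathRegret vmax ρ T F G h}ᶜ := (probReal_compl_eq_one_sub hset).symm
    _ ≤ _ := measureReal_mono fun h hh => by
        have hle : pathRegret vmax ρ T F G h ≤ (regretConst vmax ρ + 1) * deviation T :=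
          not_lt.1 hh
        exact hle.trans <| (le_add_of_nonneg_right (by positivity)).trans
          (add_mul_deviation_le hρ.le hρv hT2)

theorem integral_pathRegret_one_nonpos (hF : ∀ᵐ x ∂F, x ∈ Set.Icc 0 vmax)
    (hG : ∀ᵐ x ∂G, x ∈ Set.Icc 0 vmax) (hρ : 0 ≤ ρ) :
    ∫ h, pathRegret vmax ρ 1 F G h ∂pathMeasure F G ≤ 0 := by
  have hfirst : MeasurePreserving (fun h : Path => h 0) (pathMeasure F G) (F.prod G) :=
    measurePreserving_eval_infinitePi (fun _ : ℕ => F.prod G) 0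
  have hint : Integrable (fun z : ℝ × ℝ => reward z.1 z.2) (F.prod G) :=
    .of_mem_Icc 0 vmax measurable_reward.aemeasurable <| (ae_prod_mem_Icc hF hG).mono fun z hz =>
      Set.Icc_subset_Icc_right hz.1.2 (reward_mem_Icc hz.1.1 hz.2.1)
  have hint' : Integrable (fun h : Path => reward (h 0).1 (h 0).2) (pathMeasure F G) :=
    hfirst.integrable_comp_of_integrable hint
  have hmean : ∫ h : Path, reward (h 0).1 (h 0).2 ∂pathMeasure F G =
      ∫ z, reward z.1 z.2 ∂F.prod G := by
    rw [← hfirst.map_eq, integral_map hfirst.measurable.aemeasurable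
      measurable_reward.aestronglyMeasurable]
  simp only [pathRegret, pathRevenue_eq_sum_choice, Finset.sum_range_one, choice_zero, one_mul]
  rw [integral_sub (integrable_const _) hint', hmean]
  simpa using OPT_le_mul_integral_reward (T := 1) hρ hF hG

theorem integral_pathRegret_le (hF : ∀ᵐ x ∂F, x ∈ Set.Icc 0 vmax)
    (hG : ∀ᵐ x ∂G, x ∈ Set.Icc 0 vmax) (hρ : 0 < ρ) (hρv : ρ ≤ vmax) (hT : 1 ≤ T) :
    ∫ h, pathRegret vmax ρ T F G h ∂pathMeasure F G ≤
      regretRate vmax ρ * √(T * Real.log T) := by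
  obtain rfl | hT2 : T = 1 ∨ 2 ≤ T := by omega
  · simpa using integral_pathRegret_one_nonpos hF hG hρ.le
  have hv : 0 ≤ vmax := hρ.le.trans hρv
  have hbound : ∀ᵐ h ∂pathMeasure F G, pathRegret vmax ρ T F G h ≤ T * vmax :=
    (ae_inBox hF hG).mono fun h hh =>
      (sub_le_self _ hh.pathRevenue_mem_Icc.1).trans (OPT_le hρ.le hF hG)
  calc ∫ h, pathRegret vmax ρ T F G h ∂pathMeasure F G
      ≤ (regretConst vmax ρ + 1) * deviation T + (pathMeasure F G).real
          {h | (regretConst vmax ρ + 1) * deviation T < pathRegret vmax ρ T F G h} * (T * vmax) :=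
        integral_le_add_measureReal_mul (measurable_pathRegret hv hρ.le)
          (integrable_pathRegret hF hG hv hρ.le)
          (mul_nonneg (add_nonneg (regretConst_nonneg hρ.le hρv) zero_le_one)
            (deviation_nonneg T)) hbound
    _ ≤ (regretConst vmax ρ + 1) * deviation T + 2 / T * (T * vmax) := by
        gcongr
        exact measureReal_lt_pathRegret_le hF hG hρ hρv hT2
    _ = (regretConst vmax ρ + 1) * deviation T + 2 * vmax := by field_simp
    _ ≤ regretRate vmax ρ * √(T * Real.log T) := add_mul_deviation_le hρ.le hρv hT2

end PathRegret

section Transfer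

variable {vmax ρ : ℝ} {T : ℕ}

section Congr

variable {v v' p p' : ℕ → ℝ}

theorem rewardEst_congr {I : Finset ℕ} (hp : ∀ τ ∈ I, p τ = p' τ) :
    rewardEst T p I = rewardEst T p' I := by
  funext w
  rw [rewardEst, rewardEst, Finset.sum_congr rfl fun τ hτ => by rw [hp τ hτ]]

theorem costEst_congr {I : Finset ℕ} (hp : ∀ τ ∈ I, p τ = p' τ) :
    costEst T p I = costEst T p' I := by
  funext w
  rw [costEst, costEst, Finset.sum_congr rfl fun τ hτ => by rw [hp τ hτ]]

theorem action_congr {t : ℕ} {s : State} (hv : v t = v' t) (hp : ∀ τ ∈ s.samples, p τ = p' τ) :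
    action T v p t s = action T v' p' t s := by
  rw [action, action, rewardEst_congr hp, costEst_congr hp, hv]

theorem step_congr {t : ℕ} {s : State} (hv : v t = v' t) (hpt : p t = p' t)
    (hp : ∀ τ ∈ s.samples, p τ = p' τ) : step vmax ρ T v p t s = step vmax ρ T v' p' t s := by
  rw [step, step, action_congr hv hp, costEst_congr hp, hv, hpt]

theorem samples_step_subset (t : ℕ) (s : State) :
    (step vmax ρ T v p t s).samples ⊆ insert t s.samples := by
  by_cases hs : s.halted
  · simp [step, hs]
  · simp [step, hs]

theorem samples_stateAfter_subset (n : ℕ) :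
    (stateAfter vmax ρ T v p n).samples ⊆ Finset.Icc 1 n := by
  induction n with
  | zero => exact Finset.empty_subset _
  | succ n ih =>
    exact (samples_step_subset _ _).trans <|
      Finset.insert_subset (Finset.right_mem_Icc.2 n.succ_pos)
        (ih.trans (Finset.Icc_subset_Icc_right n.le_succ))

theorem stateAfter_congr {n : ℕ} (hv : ∀ t ∈ Finset.Icc 1 n, v t = v' t)
    (hp : ∀ t ∈ Finset.Icc 1 n, p t = p' t) :
    stateAfter vmax ρ T v p n = stateAfter vmax ρ T v' p' n := by
  induction n with
  | zero => rfl
  | succ n ih =>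
    have hlast : n + 1 ∈ Finset.Icc 1 (n + 1) := Finset.right_mem_Icc.2 n.succ_pos
    have hmono : Finset.Icc 1 n ⊆ Finset.Icc 1 (n + 1) := Finset.Icc_subset_Icc_right n.le_succ
    rw [stateAfter, stateAfter,
      ← ih (fun t ht => hv t (hmono ht)) (fun t ht => hp t (hmono ht))]
    exact step_congr (hv _ hlast) (hp _ hlast)
      fun τ hτ => hp τ (hmono (samples_stateAfter_subset n hτ))

theorem revenue_congr (hv : ∀ t ∈ Finset.Icc 1 T, v t = v' t)
    (hp : ∀ t ∈ Finset.Icc 1 T, p t = p' t) :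
    revenue vmax ρ T v p = revenue vmax ρ T v' p' := by
  refine Finset.sum_congr rfl fun t ht => ?_
  have hpast : Finset.Icc 1 (t - 1) ⊆ Finset.Icc 1 T :=
    Finset.Icc_subset_Icc_right ((t.sub_le 1).trans (Finset.mem_Icc.1 ht).2)
  rw [decision, decision, hv t ht, hp t ht,
    ← stateAfter_congr (fun t ht => hv t (hpast ht)) (fun t ht => hp t (hpast ht)),
    action_congr (hv t ht) fun τ hτ => hp τ (hpast (samples_stateAfter_subset _ hτ))]

end Congr

theorem hasLaw_prodMk_pi {Ω α ι : Type*} [MeasurableSpace Ω] {μ : Measure Ω} [MeasurableSpace α]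
    [Fintype ι] {X Y : ι → Ω → α} {κ ν : ι → Measure α} [∀ i, SigmaFinite (κ i)]
    [∀ i, SigmaFinite (ν i)] (hX : ∀ i, HasLaw (X i) (κ i) μ) (hY : ∀ i, HasLaw (Y i) (ν i) μ)
    (hXY : iIndepFun (Sum.elim X Y) μ) :
    HasLaw (fun ω i => (X i ω, Y i ω)) (Measure.pi fun i => (κ i).prod (ν i)) μ := by
  have : ∀ i, SigmaFinite (Sum.elim κ ν i) := Sum.rec ‹_› ‹_›
  have hsum : HasLaw (fun ω i => Sum.elim X Y i ω) (Measure.pi (Sum.elim κ ν)) μ :=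
    hXY.hasLaw_pi (Sum.rec hX hY)
  have hpair := (measurePreserving_sumPiEquivProdPi (Sum.elim κ ν)).trans
    (measurePreserving_arrowProdEquivProdArrow α α ι κ ν).symm
  exact hpair.hasLaw.comp hsum

/-- Path with prescribed values and bids in the rounds `1, …, T`, and value and bid `0` in the
later rounds, which the algorithm never reads. -/
def extendByZero (y : Finset.Icc 1 T → ℝ × ℝ) : Path :=
  fun n => if hn : n + 1 ∈ Finset.Icc 1 T then y ⟨n + 1, hn⟩ else 0

theorem measurable_extendByZero : Measurable (extendByZero (T := T)) := by
  refine measurable_pi_lambda _ fun n => ?_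
  by_cases hn : n + 1 ∈ Finset.Icc 1 T
  · simpa only [extendByZero, hn, dite_true] using measurable_pi_apply _
  · simpa only [extendByZero, hn, dite_false] using measurable_const

theorem extendByZero_sub_one (y : Finset.Icc 1 T → ℝ × ℝ) (t : Finset.Icc 1 T) :
    extendByZero y (t - 1) = y t := by
  have ht : (t : ℕ) - 1 + 1 = t := Nat.sub_add_cancel (Finset.mem_Icc.1 t.2).1
  simp only [extendByZero, ht, t.2, dite_true]

theorem regret_eq_pathRegret {F G : Measure ℝ} (v p : ℕ → ℝ) :
    regret vmax ρ T F G v p =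
      pathRegret vmax ρ T F G (extendByZero fun t : Finset.Icc 1 T => (v t, p t)) := by
  rw [regret, pathRegret, pathRevenue]
  congr 1
  exact revenue_congr
    (fun t ht => congrArg Prod.fst (extendByZero_sub_one (fun t => (v t, p t)) ⟨t, ht⟩).symm)
    fun t ht => congrArg Prod.snd (extendByZero_sub_one (fun t => (v t, p t)) ⟨t, ht⟩).symm

variable {F G : Measure ℝ} [IsProbabilityMeasure F] [IsProbabilityMeasure G]

theorem hasLaw_path_Icc :
    HasLaw (fun (h : Path) (t : Finset.Icc 1 T) => h (t - 1)) (Measure.pi fun _ => F.prod G)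
      (pathMeasure F G) := by
  have hinj : Function.Injective fun t : Finset.Icc 1 T => (t : ℕ) - 1 := fun s t hst =>
    Subtype.ext <| Nat.pred_inj (Finset.mem_Icc.1 s.2).1 (Finset.mem_Icc.1 t.2).1 hst
  refine ⟨(measurable_pi_lambda _ fun _ => measurable_pi_apply _).aemeasurable, ?_⟩
  rw [← Measure.infinitePi_eq_pi]
  exact Measure.map_infinitePi_infinitePi_of_inj hinj

theorem identDistrib_regret {Ω : Type*} [MeasurableSpace Ω] {μ : Measure Ω} {v p : ℕ → Ω → ℝ}
    (hv : 0 ≤ vmax) (hρ : 0 ≤ ρ) (hF : ∀ t : Finset.Icc 1 T, HasLaw (v t) F μ)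
    (hG : ∀ t : Finset.Icc 1 T, HasLaw (p t) G μ)
    (hind : iIndepFun
      (Sum.elim (fun t : Finset.Icc 1 T => v t) fun t : Finset.Icc 1 T => p t) μ) :
    IdentDistrib (fun ω => regret vmax ρ T F G (fun t => v t ω) fun t => p t ω)
      (pathRegret vmax ρ T F G) μ (pathMeasure F G) := by
  have hident := ((hasLaw_prodMk_pi hF hG hind).identDistrib hasLaw_path_Icc).comp <|
    (measurable_pathRegret (T := T) (F := F) (G := G) hv hρ).comp (measurable_extendByZero (T := T))
  convert hident using 1
  · exact funext fun ω => regret_eq_pathRegret _ _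
  · exact funext fun h => regret_eq_pathRegret (fun t => (h (t - 1)).1) fun t => (h (t - 1)).2

end Transfer

end Throttling

theorem mainTheorem4 (vmax ρ : ℝ) (hρ : 0 < ρ) (hρv : ρ ≤ vmax) :
    ∃ C : ℝ, 0 < C ∧
      ∀ (F G : MeasureTheory.Measure ℝ)
        [MeasureTheory.IsProbabilityMeasure F] [MeasureTheory.IsProbabilityMeasure G],
        (∀ᵐ x ∂F, x ∈ Set.Icc 0 vmax) → (∀ᵐ x ∂G, x ∈ Set.Icc 0 vmax) →
      ∀ (T : ℕ), 1 ≤ T →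
      ∀ (Ω : Type*) [MeasurableSpace Ω] (μ : MeasureTheory.Measure Ω)
        [MeasureTheory.IsProbabilityMeasure μ] (v p : ℕ → Ω → ℝ),
        (∀ t ∈ Finset.Icc 1 T, Measurable (v t) ∧ μ.map (v t) = F) →
        (∀ t ∈ Finset.Icc 1 T, Measurable (p t) ∧ μ.map (p t) = G) →
        ProbabilityTheory.iIndepFun
          (Sum.elim (fun t : Finset.Icc 1 T => v t) (fun t : Finset.Icc 1 T => p t)) μ →
        1 - 4 / (T : ℝ) ≤
            μ.real {ω | Throttling.regret vmax ρ T F G (fun t => v t ω) (fun t => p t ω) ≤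
              C * Real.sqrt (T * Real.log T)} ∧
          MeasureTheory.Integrable
            (fun ω => Throttling.regret vmax ρ T F G (fun t => v t ω) (fun t => p t ω)) μ ∧
          ∫ ω, Throttling.regret vmax ρ T F G (fun t => v t ω) (fun t => p t ω) ∂μ ≤
            C * Real.sqrt (T * Real.log T) := by
  have hv : 0 ≤ vmax := hρ.le.trans hρv
  refine ⟨Throttling.regretRate vmax ρ, Throttling.regretRate_pos hρ.le hρv, ?_⟩
  intro F G _ _ hF hG T hT Ω _ μ _ v p hv_law hp_law hind
  have hdist := Throttling.identDistrib_regret hv hρ.le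
    (fun t => ⟨(hv_law t t.2).1.aemeasurable, (hv_law t t.2).2⟩)
    (fun t => ⟨(hp_law t t.2).1.aemeasurable, (hp_law t t.2).2⟩) hind
  refine ⟨?_, ?_, ?_⟩
  · refine (Throttling.le_measureReal_pathRegret_le hF hG hρ hρv hT).trans_eq ?_
    exact (congrArg ENNReal.toReal (hdist.measure_mem_eq measurableSet_Iic)).symm
  · exact hdist.integrable_iff.2 (Throttling.integrable_pathRegret hF hG hv hρ.le)
  · exact hdist.integral_eq.trans_le (Throttling.integral_pathRegret_le hF hG hρ hρv hT)
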